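/- Let $G$ be a nonempty plane 1-periodic graph: a graph with signed edges $\sigma_e=\pm1$ (loops and multiple edges allowed, isolated vertices not allowed, not necessarily connected) embedded in the strip $(0,1)\times\mathbb R$ and invariant under the translation $x:(s,t)\mapsto(s,t+1)$, such that the free $\mathbb Z$-action generated by $x$ preserves signs and the quotient $\overline G$, a graph in the annulus $\mathbb A=(0,1)\times S^1$, is finite. Choose representatives $v_{1,0},\dots,v_{n,0}$ of the vertex orbits and put $v_{i,k}=x^k v_{i,0}$. The Laplacian polynomial of $G$ is $\Delta_G(x)=\det(\delta-A)\in\mathbb Z[x^{\pm1}]$, where $A_{ij}$ is the sum of the monomials $\sigma_e x^{k}$ over all edges $e$ of $G$ joining $v_{i,0}$ to $v_{j,k}$, and $\delta$ is the diagonal matrix whose entry $\delta_{ii}$ is the sum of the signs of the edges at $v_{i,0}$; loops of $\overline G$ contribute two inverse monomials to $A_{ii}$ and count twice in $\delta_{ii}$. Let $\overline\ell$ be the link in the solid torus $V=\mathbb A\times[0,1]$ with the diagram in $\mathbb A$ that is obtained from $\overline G$ by the medial construction: each edge of $\overline G$ is replaced by two strands that run parallel to it on its two sides and cross once at its middle,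 the over/under information at this crossing being determined by the sign of the edge, and the strands are joined around the vertices without further crossings. Embed $V$ as an unknotted solid torus in $S^3$, let $C$ be a meridian of $V$ encircling $V$ and let $\hat\ell=\overline\ell\cup C$ be the encircled link, with any orientation of $\overline\ell$. Let $\Delta_{\hat\ell}(t_1,\dots,t_\mu,x)$ be its multivariable Alexander polynomial, that is, a greatest common divisor of the first elementary ideal of the Alexander matrix of the Wirtinger presentation of the link group (well defined up to units of $\mathbb Z[t_1^{\pm1},\dots,t_\mu^{\pm1},x^{\pm1}]$), where the meridians of the components of $\overline\ell$ are mapped to $t_1,\dots,t_\mu$ and those of $C$ to $x$. Then $$\Delta_G(x)\ \doteq\ (x-1)\,\Delta_{\hat\ell}(-1,\dots,-1,x),$$ where $\doteq$ means equality up to multiplication by a unit of $\mathbb Z[x^{\pm1}]$. -/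

import Mathlib

open scoped LaurentPolynomial

noncomputable section

/-! ### Periodic graphs and their Laplacian polynomials -/

/-- A signed 1-periodic graph, given by its finitely many vertex orbits `V` and edge orbits `E`
(both taken finite below) under the free `ℤ`-action.
The graph itself has vertices `v_{i,n}` and edges `e_{j,n}` (`i : V`, `j : E`, `n : ℤ`), where
`e_{j,n}` has sign `sign j` and joins `v_{src j, n}` to `v_{tgt j, n + shift j}`, and `x` acts by
adding `1` to the second index. Loops and multiple edges are allowed, isolated vertices are not. -/
structure PeriodicGraph (V E : Type*) where
  src : E → V
  tgt : E → V
  shift : E → ℤ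
  sign : E → ℤˣ
  not_isolated : ∀ v, ∃ e, src e = v ∨ tgt e = v

/-- The reverse of a directed edge; `(e, true)` is the edge `e` directed from `src e` to `tgt e`,
and `(e, false)` is the same edge directed backwards. -/
def Dart.rev {E : Type*} (d : E × Bool) : E × Bool := (d.1, !d.2)

theorem Dart.rev_rev {E : Type*} (d : E × Bool) : Dart.rev (Dart.rev d) = d := by simp [Dart.rev]

namespace PeriodicGraph

variable {V E : Type*} (G : PeriodicGraph V E)

/-- Initial vertex of a directed edge of the quotient graph. -/
def start (d : E × Bool) : V := if d.2 then G.src d.1 else G.tgt d.1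

/-- The directed edge `d` of the quotient lifts to an edge from `v_{start d, 0}` to
`v_{start (rev d), dartShift d}`. -/
def dartShift (d : E × Bool) : ℤ := if d.2 then G.shift d.1 else -G.shift d.1

open Classical in
/-- The adjacency matrix over `ℤ[x, x⁻¹]`: the entry at `(i, j)` is the sum of `σ_e xⁿ` over all
edges `e` between `v_{i,0}` and `v_{j,n}`, a loop contributing two inverse monomials. -/
def adjacencyMatrix [Fintype E] : Matrix V V ℤ[T;T⁻¹] :=
  Matrix.of fun i j => ∑ d : E × Bool,
    if G.start d = i ∧ G.start (Dart.rev d) = j then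
      LaurentPolynomial.C (G.sign d.1 : ℤ) * LaurentPolynomial.T (G.dartShift d)
    else 0

open Classical in
/-- The signed degree matrix, loops counted twice. -/
def degreeMatrix [Fintype E] : Matrix V V ℤ[T;T⁻¹] :=
  Matrix.diagonal fun i => ∑ d : E × Bool,
    if G.start d = i then LaurentPolynomial.C (G.sign d.1 : ℤ) else 0

def laplacianMatrix [Fintype E] : Matrix V V ℤ[T;T⁻¹] := G.degreeMatrix - G.adjacencyMatrix

open Classical in
def laplacianPolynomial [Fintype V] [Fintype E] : ℤ[T;T⁻¹] := G.laplacianMatrix.det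

/-- The simple graph underlying the quotient graph (used to count its components). -/
def quotientGraph : SimpleGraph V :=
  SimpleGraph.fromRel fun u v => ∃ e, G.src e = u ∧ G.tgt e = v

end PeriodicGraph

/-! ### Plane periodic graphs: embeddings of the quotient graph in the annulus -/

/-- A plane 1-periodic graph: an embedding (up to homeomorphism) of the quotient graph in the open
annulus `(0,1) × S¹`, i.e. in the sphere minus two points, recorded combinatorially, with a radial
arc `γ` from the inner end of the annulus to the outer end. The plane graph is the preimage in the
strip `(0,1) × ℝ`, and the lifts of `γ` bound the fundamental domains of the `ℤ`-action.

`rot d` is the directed edge following `d` counterclockwise around its initial vertex.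
`R` is the set of regions (the components of the complement of the quotient graph in the sphere)
and `left d` is the region to the left of `d`; the corner between `d` and `rot d` lies both to the
left of `d` and to the right of `rot d`. The quotient graph may be disconnected, so a region may
have several boundary walks.
Planarity is Euler's formula `#vertices - #edges + #regions = 1 + #components`, together with the
connectedness of the sphere (the incidence graph of vertices and regions is connected).

The arc `γ` passes in succession through the distinct regions `path 0, …, path k` and, between
`path i` and `path (i+1)`, crosses the edge of `cut i` once, from the left of `cut i` to its right.
The inner and the outer end of the annulus lie in `path 0` and in `path k`.
The vertex `v_{i,0}` lies in the fundamental domain number `level i`, so that `level` and `shift`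
count the signed crossings of an edge with the lifts of `γ`. -/
structure AnnularEmbedding {V E : Type*} [Fintype V] [Fintype E] (G : PeriodicGraph V E)
    (R : Type*) [Fintype R] where
  rot : Equiv.Perm (E × Bool)
  start_rot : ∀ d, G.start (rot d) = G.start d
  sameCycle_rot : ∀ d d', G.start d = G.start d' → rot.SameCycle d d'
  left : E × Bool → R
  left_surjective : Function.Surjective left
  left_corner : ∀ d, left d = left (Dart.rev (rot d))
  connected : (SimpleGraph.fromRel fun a b : V ⊕ R =>
    ∃ d, a = Sum.inl (G.start d) ∧ b = Sum.inr (left d)).Connected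
  euler : Fintype.card V + Fintype.card R =
    Fintype.card E + 1 + Nat.card G.quotientGraph.ConnectedComponent
  k : ℕ
  cut : Fin k → E × Bool
  path : Fin (k + 1) → R
  path_injective : Function.Injective path
  left_cut : ∀ i, left (cut i) = path i.castSucc
  right_cut : ∀ i, left (Dart.rev (cut i)) = path i.succ
  level : V → ℤ
  shift_eq : ∀ e, G.shift e + level (G.tgt e) - level (G.src e) =
    (Nat.card {i // cut i = (e, true)} : ℤ) - Nat.card {i // cut i = (e, false)}

/-! ### Oriented link diagrams and the multivariable Alexander polynomial -/

/-- The combinatorial data of a diagram of an oriented link that enter the Wirtinger presentation.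
The closed curves of the diagram are cut at all crossings, and possibly at further points, into
segments. `next s` is the segment that follows `s` along the orientation. At a crossing `c`
the overpassing strand goes from the segment `overIn c` to `next (overIn c)` and the underpassing
strand from `underIn c` to `next (underIn c)`; `sign c` is the usual sign of the crossing. -/
structure LinkDiagram (S X : Type*) where
  next : S → S
  overIn : X → S
  underIn : X → S
  sign : X → ℤˣ
  next_injective : Function.Injective next
  pass_injective : Function.Injective (Sum.elim overIn underIn)

/-- `ℤ[t_c^{±1} : c ∈ K]`, the group ring of the free abelian group on `K`. -/
abbrev MvLaurent (K : Type*) := AddMonoidAlgebra ℤ (K →₀ ℤ)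

namespace MvLaurent

/-- The variable `t_c`, as a unit. -/
def var {K : Type*} (c : K) : (MvLaurent K)ˣ where
  val := AddMonoidAlgebra.single (Finsupp.single c 1) 1
  inv := AddMonoidAlgebra.single (Finsupp.single c (-1)) 1
  val_inv := by
    rw [AddMonoidAlgebra.single_mul_single, ← Finsupp.single_add, AddMonoidAlgebra.one_def]; simp
  inv_val := by
    rw [AddMonoidAlgebra.single_mul_single, ← Finsupp.single_add, AddMonoidAlgebra.one_def]; simp

/-- Evaluation of a Laurent polynomial at `t_c = u c`. -/
def eval {K A : Type*} [CommRing A] (u : K → Aˣ) : MvLaurent K →+* A :=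
  AddMonoidAlgebra.liftNCRingHom (Int.castRingHom A)
    ((Units.coeHom A).comp (AddMonoidHom.toMultiplicativeLeft
      (Finsupp.liftAddHom fun c => zmultiplesHom (Additive Aˣ) (Additive.ofMul (u c)))))
    fun _ _ => Commute.all _ _

theorem eval_var {K A : Type*} [CommRing A] (u : K → Aˣ) (c : K) :
    eval u (var c : MvLaurent K) = u c := by
  simp [eval, var]

end MvLaurent

open Classical in
/-- The Fox derivative with respect to the generator `j` of a word in the generators `α` and their
inverses (`(a, true)` is `a` and `(a, false)` is `a⁻¹`), mapped to `A` by `a ↦ t a`: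
`∂(a w) = ∂a + a ∂w` and `∂(a⁻¹ w) = -a⁻¹ ∂a + a⁻¹ ∂w`. -/
def foxDerivative {α A : Type*} [CommRing A] (t : α → Aˣ) (j : α) : List (α × Bool) → A
  | [] => 0
  | (a, true) :: w => (if a = j then 1 else 0) + (t a : A) * foxDerivative t j w
  | (a, false) :: w => ((t a)⁻¹ : Aˣ) * (foxDerivative t j w - if a = j then 1 else 0)

namespace LinkDiagram

variable {S X : Type*} (D : LinkDiagram S X)

/-- The components of the link. -/
def Component : Type _ := Quot fun s s' : S => D.next s = s'

/-- The arcs of the diagram: consecutive segments belong to the same arc unless they are separated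
by an undercrossing. -/
def Arc : Type _ := Quot fun s s' : S => D.next s = s' ∧ s ∉ Set.range D.underIn

def arc (s : S) : D.Arc := Quot.mk _ s

def arcComponent : D.Arc → D.Component := Quot.map id fun _ _ h => h.1

/-- The Wirtinger relator of a crossing, `o⁻¹ i o u⁻¹` or `o i o⁻¹ u⁻¹` according to its sign, where
`o` is the overcrossing arc and `i`, `u` are the incoming and outgoing undercrossing arcs. -/
def wirtingerRelator (c : X) : List (D.Arc × Bool) :=
  let o := D.arc (D.overIn c)
  let i := D.arc (D.underIn c)
  let u := D.arc (D.next (D.underIn c))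
  if D.sign c = 1 then [(o, false), (i, true), (o, true), (u, false)]
  else [(o, true), (i, true), (o, false), (u, false)]

/-- The Alexander matrix of the Wirtinger presentation: the meridians of the component `c` are
mapped to `t_c`. -/
def alexanderMatrix : Matrix X D.Arc (MvLaurent D.Component) :=
  Matrix.of fun c j =>
    foxDerivative (fun a => MvLaurent.var (D.arcComponent a)) j (D.wirtingerRelator c)

open Classical in
/-- The minor of the Alexander matrix on all columns but `j` and on the rows `f`. -/
def alexanderMinor [Fintype S] (j : D.Arc) (f : {a : D.Arc // a ≠ j} → X) :
    MvLaurent D.Component :=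
  letI : Finite D.Arc := inferInstanceAs (Finite (Quot _))
  letI : Fintype {a : D.Arc // a ≠ j} := Fintype.ofFinite _
  (Matrix.of fun a b : {a : D.Arc // a ≠ j} => D.alexanderMatrix (f a) b.1).det

/-- The first elementary ideal, generated by the minors of size (number of arcs) - 1. -/
def elementaryIdeal [Fintype S] : Ideal (MvLaurent D.Component) :=
  Ideal.span {p | ∃ j f, p = D.alexanderMinor j f}

/-- `Δ` is a multivariable Alexander polynomial of the link: a greatest common divisor of the first
elementary ideal (unique up to units). -/
def IsAlexanderPolynomial [Fintype S] (Δ : MvLaurent D.Component) : Prop :=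
  ∀ δ, δ ∣ Δ ↔ ∀ p ∈ D.elementaryIdeal, δ ∣ p

end LinkDiagram

/-! ### The encircled medial link -/

namespace AnnularEmbedding

variable {V E R : Type*} [Fintype V] [Fintype E] [Fintype R] {G : PeriodicGraph V E}
  (P : AnnularEmbedding G R)

/-- In the medial diagram every corner (between `d` and `rot d`, named by `d`) carries a strand that
joins the crossing in the middle of the edge of `d` to the crossing in the middle of the edge of
`rot d`. At the crossing of the edge `e`, directed as `d`, the strand of the corner `d` goes straight
on to the strand of the corner `rev d` (the first strand at `e`), and the strand of the corner
`rot⁻¹ d` goes straight on to the strand of the corner `rot⁻¹ (rev d)` (the second strand at `e`).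

An orientation of the medial link says of every corner `d` whether its strand is directed from the
edge of `d` to the edge of `rot d` (`true`) or backwards (`false`), consistently at all crossings. -/
structure Orientation where
  dir : E × Bool → Bool
  dir_first : ∀ d, dir (Dart.rev d) = !dir d
  dir_second : ∀ d, dir (P.rot.symm (Dart.rev d)) = !dir (P.rot.symm d)

/-- Segments of the diagram of the encircled link.

The circle `C` runs along `γ` on both sides of it: `front` is parallel to `γ` and passes over all
strands of the medial link, `back` is antiparallel to `γ` and passes under all strands. Both
parallels meet `2k` strands and are cut there into `2k + 1` segments, numbered in the direction
of `γ`.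

The arc `γ` crosses the edge of `d = cut i` between the initial vertex of `d` and the middle of the
edge. So it first meets the strand of the corner `d`, near the crossing of the edge of `d`, and then
the strand of the corner `rot⁻¹ d`, near the crossing of the edge of `d`. The front parallel is on
the side of the initial vertex of `d`, the back parallel on the side of the crossing.
The strand of every corner `d` is cut into five segments, numbered from `0` (at the edge of
`d`) to `4` (at the edge of `rot d`): if `γ` crosses the strand near the edge of `d`, then `back` and
`front` separate `0`, `1` and `1`, `2`, respectively; if it does so near the edge of `rot d`, then
`front` and `back` separate `2`, `3` and `3`, `4`, respectively. -/
inductive Segment (P : AnnularEmbedding G R) : Type _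
  | strand (d : E × Bool) (j : Fin 5)
  | front (j : Fin (2 * P.k + 1))
  | back (j : Fin (2 * P.k + 1))

/-- Segments are finite in number. -/
def segmentEquiv :
    ((E × Bool) × Fin 5) ⊕ (Fin (2 * P.k + 1) ⊕ Fin (2 * P.k + 1)) ≃ P.Segment where
  toFun
    | Sum.inl (d, j) => .strand d j
    | Sum.inr (Sum.inl j) => .front j
    | Sum.inr (Sum.inr j) => .back j
  invFun
    | .strand d j => Sum.inl (d, j)
    | .front j => Sum.inr (Sum.inl j)
    | .back j => Sum.inr (Sum.inr j)
  left_inv := by rintro (_ | _ | _) <;> rfl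
  right_inv := by rintro (_ | _ | _) <;> rfl

instance : Fintype P.Segment := Fintype.ofEquiv _ P.segmentEquiv

/-- Crossings of the diagram of the encircled link: one in the middle of every edge, and four for
each crossing of `γ` with an edge. -/
inductive Crossing (P : AnnularEmbedding G R) : Type _
  | edge (e : E)
  | firstFront (i : Fin P.k)
  | firstBack (i : Fin P.k)
  | secondFront (i : Fin P.k)
  | secondBack (i : Fin P.k)

variable {P} (o : P.Orientation)

/-- The successor of a segment. Strands go straight on at the crossings in the middle of the edges;
`front` and `back` are joined to each other at both ends. -/
def nextSegment : P.Segment → P.Segment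
  | .strand d j =>
    if o.dir d then
      if h : (j : ℕ) < 4 then .strand d ⟨j + 1, by omega⟩
      else .strand (P.rot.symm (Dart.rev (P.rot d))) 4
    else
      if (j : ℕ) = 0 then .strand (Dart.rev d) 0 else .strand d ⟨j - 1, by omega⟩
  | .front j => if h : (j : ℕ) < 2 * P.k then .front ⟨j + 1, by omega⟩ else .back j
  | .back j => if (j : ℕ) = 0 then .front j else .back ⟨j - 1, by omega⟩

/-- The incoming segment of the first strand at the crossing of the edge `e`. -/
def firstIn (e : E) : P.Segment :=
  .strand (if o.dir (e, true) then (e, false) else (e, true)) 0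

/-- The incoming segment of the second strand at the crossing of the edge `e`. -/
def secondIn (e : E) : P.Segment :=
  .strand (P.rot.symm (if o.dir (P.rot.symm (e, true)) then (e, true) else (e, false))) 4

/-- The incoming segment of the overcrossing strand. The first strand passes over at the positive
edges and the second strand at the negative edges. -/
def overSegment : P.Crossing → P.Segment
  | .edge e => if G.sign e = 1 then firstIn o e else secondIn o e
  | .firstFront i => .front ⟨2 * i, by omega⟩
  | .firstBack i => .strand (P.cut i) (if o.dir (P.cut i) then 0 else 1)
  | .secondFront i => .front ⟨2 * i + 1, by omega⟩
  | .secondBack i =>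
    .strand (P.rot.symm (P.cut i)) (if o.dir (P.rot.symm (P.cut i)) then 3 else 4)

/-- The incoming segment of the undercrossing strand. -/
def underSegment : P.Crossing → P.Segment
  | .edge e => if G.sign e = 1 then secondIn o e else firstIn o e
  | .firstFront i => .strand (P.cut i) (if o.dir (P.cut i) then 1 else 2)
  | .firstBack i => .back ⟨2 * i + 1, by omega⟩
  | .secondFront i =>
    .strand (P.rot.symm (P.cut i)) (if o.dir (P.rot.symm (P.cut i)) then 2 else 3)
  | .secondBack i => .back ⟨2 * i + 2, by omega⟩

/-- The sign of a crossing. The crossing of two oriented strands is positive if the overpassing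
strand has to be turned counterclockwise by less than `π` to agree with the underpassing one. -/
def crossingSign : P.Crossing → ℤˣ
  | .edge e =>
    G.sign e * (if o.dir (e, true) then -1 else 1) *
      (if o.dir (P.rot.symm (e, true)) then 1 else -1)
  | .firstFront i => if o.dir (P.cut i) then -1 else 1
  | .firstBack i => if o.dir (P.cut i) then -1 else 1
  | .secondFront i => if o.dir (P.rot.symm (P.cut i)) then 1 else -1
  | .secondBack i => if o.dir (P.rot.symm (P.cut i)) then 1 else -1

theorem nextSegment_injective : Function.Injective (nextSegment o) := by
  have h2 : ∀ d, o.dir (P.rot.symm (Dart.rev (P.rot d))) = !o.dir d := fun d => by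
    simpa using o.dir_second (P.rot d)
  have hr : ∀ d d' : E × Bool, Dart.rev d = Dart.rev d' → d = d' := fun d d' h => by
    rw [← Dart.rev_rev d, h, Dart.rev_rev]
  have hd := o.dir_first
  rintro (⟨d, j⟩ | j | j) (⟨d', j'⟩ | j' | j') h <;> simp only [nextSegment] at h
  · have key : o.dir d = o.dir d' → d = d' ∧ j = j' := by
      intro hdd
      split_ifs at h <;> simp only [Segment.strand.injEq, Fin.ext_iff] at h <;>
        grind [P.rot.symm.injective.eq_iff, P.rot.injective.eq_iff]
    have : o.dir d = o.dir d' := by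
      by_contra hne
      split_ifs at h <;> simp only [Segment.strand.injEq, Fin.ext_iff] at h <;> grind
    obtain ⟨rfl, rfl⟩ := key this
    rfl
  all_goals
    split_ifs at h <;>
      simp_all only [Segment.front.injEq, Segment.back.injEq, Fin.ext_iff, reduceCtorEq] <;> grind

theorem cut_injective : Function.Injective P.cut := fun i i' h => by
  have := P.left_cut i
  rw [h, P.left_cut] at this
  simpa using (P.path_injective this).symm

set_option maxHeartbeats 2000000 in
theorem pass_injective :
    Function.Injective (Sum.elim (overSegment o) (underSegment o)) := by
  have hf : ∀ e, ∃ d, d.1 = e ∧ o.dir d = false ∧ firstIn o e = .strand d 0 := fun e => by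
    have := o.dir_first (e, true)
    by_cases h : o.dir (e, true)
    · exact ⟨(e, false), rfl, by simpa [Dart.rev, h] using this, by simp [firstIn, h]⟩
    · exact ⟨(e, true), rfl, by simpa using h, by simp [firstIn, h]⟩
  have hs : ∀ e, ∃ d, (P.rot d).1 = e ∧ o.dir d = true ∧ secondIn o e = .strand d 4 := fun e => by
    have := o.dir_second (e, true)
    by_cases h : o.dir (P.rot.symm (e, true))
    · exact ⟨P.rot.symm (e, true), by simp, h, by simp [secondIn, h]⟩
    · exact ⟨P.rot.symm (e, false), by simp, by simpa [Dart.rev, h] using this,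
        by simp [secondIn, h]⟩
  choose f hf1 hf2 hf3 using hf
  choose g hg1 hg2 hg3 using hs
  have hc := P.cut_injective
  have hc' : ∀ i i', P.rot.symm (P.cut i) = P.rot.symm (P.cut i') → i = i' := fun i i' h =>
    hc (P.rot.symm.injective h)
  rintro ((_ | _ | _ | _ | _) | (_ | _ | _ | _ | _))
    ((_ | _ | _ | _ | _) | (_ | _ | _ | _ | _)) h <;>
    simp only [Sum.elim_inl, Sum.elim_inr, overSegment, underSegment, hf3, hg3] at h <;>
    (try split_ifs at h) <;>
    simp only [Segment.strand.injEq, Segment.front.injEq, Segment.back.injEq, Fin.mk.injEq,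
      Fin.reduceEq, and_false, and_true, reduceCtorEq] at h <;>
    first
    | omega
    | (obtain rfl := hc h; first | rfl | contradiction)
    | (obtain rfl := hc' _ _ h; first | rfl | contradiction)
    | (simp_all; done)
    | grind

/-- The diagram of the encircled link: the medial link in the solid torus (annulus times interval),
together with a meridian `C` of that solid torus. -/
def encircledLink : LinkDiagram P.Segment P.Crossing where
  next := nextSegment o
  overIn := overSegment o
  underIn := underSegment o
  sign := crossingSign o
  next_injective := nextSegment_injective o
  pass_injective := pass_injective o

/-- The component `C` of the encircled link. -/
def circle : (encircledLink o).Component := Quot.mk _ (.front 0)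

open Classical in
/-- The substitution of `x` for the variable of `C` and of `-1` for all other variables. -/
def specialize : MvLaurent (encircledLink o).Component →+* ℤ[T;T⁻¹] :=
  MvLaurent.eval fun c =>
    if c = circle o then (LaurentPolynomial.isUnit_T (R := ℤ) 1).unit else -1

end AnnularEmbedding

end

noncomputable section

/-! ### Presentation matrices -/

-- Omit from the Alexander matrix the column of the overpassing arc of C and one row. The resulting
-- minor is (t_C - 1) times the Alexander polynomial, up to a unit: Fox's fundamental formula
-- relates the minors that omit different columns (`exists_alexanderMinor_mul_eq`), an Alexander
-- numbering of the diagram makes one Wirtinger relator redundant (`exists_numbering`,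
-- `IsNumbering.row_mem_span`), and C is not the only component (`exists_isAlexanderPolynomial`).
-- This is the source of the factor x - 1. What remains is that this minor, specialized at t_i = -1
-- and t_C = x, is associated to the determinant of the Laplacian.
--
-- Two square linear systems have associated determinants if, in every module, each solution of one
-- yields a solution of the other whose span contains it (`Matrix.det_dvd_det_of_solutions`).
-- Solutions of the specialized Alexander system are colorings of the diagram: the front of C has
-- color zero, passing under it costs a factor x, and at a crossing of the medial link twice the
-- over color is the sum of the two under colors. Solutions of the Laplacian system are, after
-- rescaling by powers of x, vertex functions w that are harmonic for the connection with holonomy x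
-- across γ.
--
-- To pass from one to the other, the color m of the corners is written as w + ρ, a vertex function
-- plus a twisted region function. The jump f of the color across an edge is minus or plus the
-- twisted difference of w, according to the sign of the edge, and the twisted jumps around a vertex
-- add up to zero: so w is harmonic. Conversely a harmonic w prescribes f, and integrating f
-- produces ρ. The integration rests on H¹ = 0 for the sphere (`exists_potential`), a consequence of
-- Euler's formula, and on its twisted form (`exists_twisted_potential`). The obstruction to the
-- latter is the flow across γ; it can be corrected because x - 1 annihilates the total flow, and
-- also the partial flow wherever γ enters and leaves a region through different boundary walks.

universe u₁ u₂ u₃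

/-- It suffices to use the universal solution in the cokernel of L. Lifting the data from there
gives X L = N M and Y L = 1 - Ψ M, and the block identity `key` then exhibits det N as a multiple of
det L. -/
theorem Matrix.det_dvd_det_of_solutions {A : Type u₁} [CommRing A] {n : Type u₂} {k : Type u₃}
    [Fintype n] [DecidableEq n] [Fintype k] [DecidableEq k]
    (L : Matrix n n A) (N : Matrix k k A)
    (h : ∀ (W : Type (max u₁ u₂)) [AddCommGroup W] [Module A W] (e : n → W),
      (∀ i, ∑ j, L i j • e j = 0) →
        ∃ m : k → W, (∀ i, ∑ j, N i j • m j = 0) ∧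
          ∀ i, e i ∈ Submodule.span A (Set.range m)) :
    L.det ∣ N.det := by
  let K : Submodule A (n → A) := Submodule.span A (Set.range fun i => L i)
  have hsum : ∀ v : n → A, ∑ j, v j • (Pi.single j 1 : n → A) = v := fun v => by
    ext i; simp [Finset.sum_apply, Pi.single_apply]
  obtain ⟨m, hm, hspan⟩ := h ((n → A) ⧸ K) (fun j => K.mkQ (Pi.single j 1)) (fun i => by
    simp_rw [← map_smul, ← map_sum, hsum]
    exact (Submodule.Quotient.mk_eq_zero K).2 (Submodule.subset_span ⟨i, rfl⟩))
  have hK : ∀ v ∈ K, ∃ y : n → A, ∑ l, y l • L l = v := fun v hv =>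
    (Submodule.mem_span_range_iff_exists_fun A).1 hv
  choose M hM using fun j => K.mkQ_surjective (m j)
  choose Ψ hΨ using fun i => (Submodule.mem_span_range_iff_exists_fun A).1 (hspan i)
  have hX : ∀ i, ∃ y : n → A, ∑ l, y l • L l = ∑ j, N i j • M j := fun i => by
    apply hK
    rw [← Submodule.Quotient.mk_eq_zero, ← Submodule.mkQ_apply, map_sum]
    simpa only [map_smul, hM] using hm i
  have hY : ∀ i, ∃ y : n → A, ∑ l, y l • L l = Pi.single i 1 - ∑ j, Ψ i j • M j := fun i => by
    apply hK
    rw [← Submodule.Quotient.mk_eq_zero, ← Submodule.mkQ_apply, map_sub, map_sum, sub_eq_zero]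
    simpa only [map_smul, hM] using (hΨ i).symm
  choose X hX using hX
  choose Y hY using hY
  have hX' : Matrix.of X * L = N * Matrix.of M := by
    ext i j
    simpa [Matrix.mul_apply, Finset.sum_apply] using congrFun (hX i) j
  have hY' : Matrix.of Y * L = 1 - Matrix.of Ψ * Matrix.of M := by
    ext i j
    simpa [Matrix.mul_apply, Finset.sum_apply, Matrix.one_apply, Pi.single_apply, eq_comm]
      using congrFun (hY i) j
  have key : Matrix.fromBlocks N (Matrix.of X) (-Matrix.of Ψ) (Matrix.of Y) *
      Matrix.fromBlocks 1 (-(Matrix.of M)) 0 L =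
      Matrix.fromBlocks N 0 (-(Matrix.of Ψ)) 1 := by
    rw [Matrix.fromBlocks_multiply]
    congr 1
    · simp
    · rw [Matrix.mul_neg, hX', neg_add_cancel]
    · simp
    · rw [Matrix.neg_mul, Matrix.mul_neg, neg_neg, hY', add_sub_cancel]
  have := congrArg Matrix.det key
  rw [Matrix.det_mul, Matrix.det_fromBlocks_zero₂₁, Matrix.det_fromBlocks_zero₁₂] at this
  simp only [Matrix.det_one, one_mul, mul_one] at this
  exact ⟨_, by rw [← this, mul_comm]⟩

/-! ### Laurent polynomials in several variables -/

namespace MvLaurent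

variable {K : Type*}

/-- Monomials, as units. -/
def monomial (g : K →₀ ℤ) : (MvLaurent K)ˣ :=
  (AddMonoidAlgebra.of ℤ (K →₀ ℤ)).toHomUnits (Multiplicative.ofAdd g)

theorem monomial_add (g h : K →₀ ℤ) : monomial (g + h) = monomial g * monomial h := by
  simp [monomial, ofAdd_add]

theorem monomial_single (c : K) : monomial (Finsupp.single c 1) = (var c : (MvLaurent K)ˣ) := by
  ext; rfl

theorem ringHom_ext {A : Type*} [CommRing A] {f g : MvLaurent K →+* A}
    (h : ∀ c : K, f (var c : MvLaurent K) = g (var c : MvLaurent K)) : f = g := by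
  let F (φ : MvLaurent K →+* A) : (K →₀ ℤ) →+ Additive Aˣ :=
    MonoidHom.toAdditiveRight
      ((Units.map φ.toMonoidHom).comp (AddMonoidAlgebra.of ℤ (K →₀ ℤ)).toHomUnits)
  have hF : F f = F g := by
    apply Finsupp.addHom_ext'
    intro c
    apply AddMonoidHom.ext_int
    apply Additive.toMul.injective
    ext
    exact h c
  apply AddMonoidAlgebra.ringHom_ext
  · intro r
    have : (AddMonoidAlgebra.single 0 r : MvLaurent K) = (r : MvLaurent K) := by
      simp [AddMonoidAlgebra.intCast_def]
    rw [this, map_intCast, map_intCast]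
  · intro a
    have := congrArg (fun x => ((Additive.toMul x : Aˣ) : A)) (DFunLike.congr_fun hF a)
    exact this

theorem eval_eq_zero_of_dvd {A : Type*} [CommRing A] {u : K → Aˣ} {c : K} (hc : u c = 1)
    {p : MvLaurent K} (h : (var c : MvLaurent K) - 1 ∣ p) : eval u p = 0 := by
  obtain ⟨q, rfl⟩ := h
  simp [eval_var, hc]

open Classical in
-- Modulo t_c - 1, the substitution t_c = 1 is the identity.
theorem var_sub_one_dvd_iff (c : K) (p : MvLaurent K) :
    (var c : MvLaurent K) - 1 ∣ p ↔ eval (fun k => if k = c then 1 else var k) p = 0 := by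
  refine ⟨eval_eq_zero_of_dvd (by simp), fun h => ?_⟩
  let I : Ideal (MvLaurent K) := Ideal.span {(var c : MvLaurent K) - 1}
  have key : (Ideal.Quotient.mk I).comp (eval (fun k => if k = c then 1 else var k)) =
      Ideal.Quotient.mk I := by
    apply ringHom_ext
    intro k
    rw [RingHom.comp_apply, eval_var]
    split_ifs with hk
    · subst hk
      rw [eq_comm, Ideal.Quotient.eq]
      exact Ideal.subset_span rfl
    · rfl
  have := DFunLike.congr_fun key p
  rw [RingHom.comp_apply, h, map_zero, eq_comm, Ideal.Quotient.eq_zero_iff_mem] at this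
  exact Ideal.mem_span_singleton.1 this

theorem var_ne_one (c : K) : (var c : MvLaurent K) ≠ 1 := by
  intro h
  have h2 := congrArg (eval (fun _ => (-1 : ℤˣ))) h
  rw [eval_var, map_one] at h2
  norm_num at h2

/-- The substitution t_c = 1 leaves t_{c'} - 1 nonzero, and the ring is a domain. This is all the
coprimality that the gcd computation needs. -/
theorem var_sub_one_dvd_of_dvd_mul {c c' : K} (hc : c ≠ c') {p : MvLaurent K}
    (h : (var c : MvLaurent K) - 1 ∣ p * ((var c' : MvLaurent K) - 1)) :
    (var c : MvLaurent K) - 1 ∣ p := by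
  classical
  rw [var_sub_one_dvd_iff] at h ⊢
  rw [map_mul, map_sub, map_one, eval_var, if_neg hc.symm] at h
  exact (mul_eq_zero.1 h).resolve_right (sub_ne_zero.2 (var_ne_one c'))

end MvLaurent

/-! ### The first elementary ideal of a link diagram -/

namespace LinkDiagram

variable {S X : Type*} (D : LinkDiagram S X)

def component (s : S) : D.Component := Quot.mk _ s

theorem component_next (s : S) : D.component (D.next s) = D.component s :=
  (Quot.sound (r := fun s s' : S => D.next s = s') rfl).symm

theorem arcComponent_arc (s : S) : D.arcComponent (D.arc s) = D.component s := rfl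

theorem arc_next {s : S} (h : s ∉ Set.range D.underIn) : D.arc (D.next s) = D.arc s :=
  (Quot.sound ⟨rfl, h⟩).symm

open Classical in
-- The coefficient of the outgoing arc is -1 because both underpassing arcs lie on one component and
-- have the same variable.
theorem alexanderMatrix_row (c : X) :
    D.alexanderMatrix c =
      if D.sign c = 1 then
        ((MvLaurent.var (D.component (D.overIn c)))⁻¹ *
            ((MvLaurent.var (D.component (D.underIn c)) : MvLaurent D.Component) - 1) :
              MvLaurent D.Component) • Pi.single (D.arc (D.overIn c)) 1 +
          (((MvLaurent.var (D.component (D.overIn c)))⁻¹ : (MvLaurent D.Component)ˣ) :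
            MvLaurent D.Component) • Pi.single (D.arc (D.underIn c)) 1 -
          Pi.single (D.arc (D.next (D.underIn c))) 1
      else
        (1 - MvLaurent.var (D.component (D.underIn c)) :
              MvLaurent D.Component) • Pi.single (D.arc (D.overIn c)) 1 +
          (MvLaurent.var (D.component (D.overIn c)) :
            MvLaurent D.Component) • Pi.single (D.arc (D.underIn c)) 1 -
          Pi.single (D.arc (D.next (D.underIn c))) 1 := by
  ext j : 1
  have hs : ∀ a : D.Arc, (if a = j then (1 : MvLaurent D.Component) else 0) =
      (Pi.single a (1 : MvLaurent D.Component) : D.Arc → MvLaurent D.Component) j := fun a => by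
    simp [Pi.single_apply, eq_comm]
  have hvv : ∀ t : (MvLaurent D.Component)ˣ, (t : MvLaurent D.Component) * (t⁻¹ : _ˣ) = 1 :=
    fun t => Units.mul_inv t
  unfold alexanderMatrix wirtingerRelator
  simp only [Matrix.of_apply]
  split_ifs with h
  · simp only [foxDerivative, arcComponent_arc, component_next, hs, Pi.add_apply, Pi.sub_apply,
      Pi.smul_apply, smul_eq_mul]
    linear_combination (-(Pi.single (D.arc (D.next (D.underIn c))) 1 :
        D.Arc → MvLaurent D.Component) j) *
        (MvLaurent.var (D.component (D.underIn c)) * ((MvLaurent.var (D.component (D.underIn c)))⁻¹ :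
          (MvLaurent D.Component)ˣ) : MvLaurent D.Component) *
          hvv (MvLaurent.var (D.component (D.overIn c))) -
        (Pi.single (D.arc (D.next (D.underIn c))) 1 : D.Arc → MvLaurent D.Component) j *
        hvv (MvLaurent.var (D.component (D.underIn c)))
  · simp only [foxDerivative, arcComponent_arc, component_next, hs, Pi.add_apply, Pi.sub_apply,
      Pi.smul_apply, smul_eq_mul]
    linear_combination (-(Pi.single (D.arc (D.next (D.underIn c))) 1 :
        D.Arc → MvLaurent D.Component) j) *
        (MvLaurent.var (D.component (D.underIn c)) * ((MvLaurent.var (D.component (D.underIn c)))⁻¹ :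
          (MvLaurent D.Component)ˣ) : MvLaurent D.Component) *
          hvv (MvLaurent.var (D.component (D.overIn c))) -
        (Pi.single (D.arc (D.next (D.underIn c))) 1 : D.Arc → MvLaurent D.Component) j *
        hvv (MvLaurent.var (D.component (D.underIn c))) -
        (MvLaurent.var (D.component (D.underIn c)) : MvLaurent D.Component) *
        (Pi.single (D.arc (D.overIn c)) 1 : D.Arc → MvLaurent D.Component) j *
        hvv (MvLaurent.var (D.component (D.overIn c)))

/-- Fox's fundamental formula: the sum of (∂r/∂a)(a - 1) is r - 1, and a relator maps to 1. -/
theorem alexanderMatrix_mulVec [Fintype D.Arc] (c : X) :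
    ∑ j, D.alexanderMatrix c j * ((MvLaurent.var (D.arcComponent j) : MvLaurent D.Component) - 1)
      = 0 := by
  classical
  have hvv : ∀ t : (MvLaurent D.Component)ˣ, (t : MvLaurent D.Component) * (t⁻¹ : _ˣ) = 1 :=
    fun t => Units.mul_inv t
  rw [alexanderMatrix_row]
  split_ifs <;>
  simp only [Pi.add_apply, Pi.sub_apply, Pi.smul_apply, smul_eq_mul, sub_mul, add_mul,
    Finset.sum_sub_distrib, Finset.sum_add_distrib, mul_assoc, ← Finset.mul_sum,
    Pi.single_apply, ite_mul, zero_mul, one_mul, Finset.sum_ite_eq',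
    Finset.mem_univ, if_true, arcComponent_arc, component_next]
  · linear_combination ((MvLaurent.var (D.component (D.underIn c)) : MvLaurent D.Component) - 1) *
      hvv (MvLaurent.var (D.component (D.overIn c)))
  · ring

end LinkDiagram

namespace LinkDiagram

variable {S X : Type*} (D : LinkDiagram S X)

/-- The rows of the Alexander matrix. -/
def alexanderRow (c : X) : D.Arc → MvLaurent D.Component := fun j => D.alexanderMatrix c j

theorem alexanderMinor_eq [Fintype S] (j : D.Arc) [Fintype {a : D.Arc // a ≠ j}]
    [DecidableEq {a : D.Arc // a ≠ j}] (f : {a : D.Arc // a ≠ j} → X) :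
    D.alexanderMinor j f =
      (Matrix.of fun a b : {a : D.Arc // a ≠ j} => D.alexanderMatrix (f a) b.1).det := by
  unfold alexanderMinor
  congr!

/-- The rows `f'` are a square matrix times the rows `f`, and determinants multiply. -/
theorem alexanderMinor_dvd [Fintype S] {j : D.Arc} (f f' : {a : D.Arc // a ≠ j} → X)
    (h : ∀ c, D.alexanderRow c ∈
      Submodule.span (MvLaurent D.Component) (Set.range (D.alexanderRow ∘ f))) :
    D.alexanderMinor j f ∣ D.alexanderMinor j f' := by
  classical
  let : Finite D.Arc := inferInstanceAs (Finite (Quot _))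
  let : Fintype {a : D.Arc // a ≠ j} := Fintype.ofFinite _
  rw [alexanderMinor_eq, alexanderMinor_eq]
  choose Z hZ using fun a => (Submodule.mem_span_range_iff_exists_fun (MvLaurent D.Component)).1
    (h (f' a))
  refine ⟨(Matrix.of Z).det, ?_⟩
  rw [mul_comm, ← Matrix.det_mul]
  congr 1
  ext1 a b
  simpa [Matrix.mul_apply, Finset.sum_apply, alexanderRow] using (congrFun (hZ a) b.1).symm

/-- The columns satisfy a linear relation with coefficients t_a - 1, so column j can be exchanged
for column j' at the cost of these factors. -/
theorem exists_alexanderMinor_mul_eq [Fintype S] (j j' : D.Arc)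
    (f : {a : D.Arc // a ≠ j} → X) :
    ∃ f' : {a : D.Arc // a ≠ j'} → X, Set.range f' = Set.range f ∧ ∃ ε : ℤˣ,
      D.alexanderMinor j' f' * ((MvLaurent.var (D.arcComponent j) : MvLaurent D.Component) - 1) =
        (ε : ℤ) * (D.alexanderMinor j f *
          ((MvLaurent.var (D.arcComponent j') : MvLaurent D.Component) - 1)) := by
  classical
  let : Finite D.Arc := inferInstanceAs (Finite (Quot _))
  let : Fintype D.Arc := Fintype.ofFinite _
  by_cases hj : j' = j
  · subst hj
    exact ⟨f, rfl, 1, by simp⟩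
  let e : {a : D.Arc // a ≠ j} ≃ {a : D.Arc // a ≠ j'} :=
    (Equiv.swap j j').subtypeEquiv fun a => by
      simp [Equiv.swap_apply_eq_iff]
  refine ⟨f ∘ e.symm, by rw [Set.range_comp, e.symm.range_eq_univ, Set.image_univ], -1, ?_⟩
  set v : D.Arc → MvLaurent D.Component := fun a =>
    (MvLaurent.var (D.arcComponent a) : MvLaurent D.Component) - 1 with hv
  rw [alexanderMinor_eq, alexanderMinor_eq]
  set M : Matrix {a : D.Arc // a ≠ j} {a : D.Arc // a ≠ j} (MvLaurent D.Component) :=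
    Matrix.of fun a b => D.alexanderMatrix (f a) b.1 with hM
  have h1 : (Matrix.of fun a b : {a : D.Arc // a ≠ j'} =>
      D.alexanderMatrix ((f ∘ e.symm) a) b.1).det =
      (M.updateCol ⟨j', hj⟩ fun a => D.alexanderMatrix (f a) j).det := by
    rw [← Matrix.det_submatrix_equiv_self e]
    congr 1
    ext1 a b
    simp only [Matrix.submatrix_apply, Matrix.of_apply, Function.comp_apply,
      Equiv.symm_apply_apply, Matrix.updateCol_apply, hM]
    have he : (e b).1 = Equiv.swap j j' b.1 := rfl
    rw [he]
    split_ifs with hb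
    · rw [hb, Equiv.swap_apply_right]
    · rw [Equiv.swap_apply_of_ne_of_ne b.2 fun h => hb (Subtype.ext h)]
  -- By the relation, v j times column j is minus the combination of the remaining columns, of which
  -- only column j' contributes to the determinant.
  have h2 : v j • (M.updateCol ⟨j', hj⟩ fun a => D.alexanderMatrix (f a) j).det =
      -(v j' • M.det) := by
    rw [smul_eq_mul, ← Matrix.det_updateCol_smul, ← neg_smul]
    refine Eq.trans ?_ (Matrix.det_updateCol_sum M ⟨j', hj⟩ fun b => -v b.1)
    congr 2
    ext1 a
    have := D.alexanderMatrix_mulVec (f a)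
    rw [Fintype.sum_eq_add_sum_subtype_ne _ j] at this
    simp only [Pi.smul_apply, smul_eq_mul, neg_mul, Finset.sum_neg_distrib, hM, Matrix.of_apply]
    rw [eq_neg_iff_add_eq_zero, ← this]
    simp only [hv, mul_comm]
  rw [h1]
  simp only [smul_eq_mul] at h2
  push_cast
  linear_combination h2

/-- If some rows span all rows of the Alexander matrix, and the link has at least two components,
then a minor on these rows is the Alexander polynomial up to an elementary factor. -/
theorem exists_isAlexanderPolynomial [Fintype S] (j j₁ : D.Arc)
    (hj : D.arcComponent j ≠ D.arcComponent j₁) (f : {a : D.Arc // a ≠ j} → X)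
    (h : ∀ c, D.alexanderRow c ∈
      Submodule.span (MvLaurent D.Component) (Set.range (D.alexanderRow ∘ f))) :
    ∃ q, D.IsAlexanderPolynomial q ∧ D.alexanderMinor j f =
      ((MvLaurent.var (D.arcComponent j) : MvLaurent D.Component) - 1) * q := by
  have hne : ∀ c : D.Component, (MvLaurent.var c : MvLaurent D.Component) - 1 ≠ 0 := fun c =>
    sub_ne_zero.2 (MvLaurent.var_ne_one c)
  have hu : ∀ ε : ℤˣ, IsUnit (((ε : ℤ) : MvLaurent D.Component)) := fun ε =>
    (Units.isUnit ε).map (Int.castRingHom _)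
  have key : ∀ j' : D.Arc, ∃ f' : {a : D.Arc // a ≠ j'} → X,
      (∀ c, D.alexanderRow c ∈
        Submodule.span (MvLaurent D.Component) (Set.range (D.alexanderRow ∘ f'))) ∧
      ∃ ε : (MvLaurent D.Component)ˣ, D.alexanderMinor j' f' *
          ((MvLaurent.var (D.arcComponent j) : MvLaurent D.Component) - 1) =
        ε * (D.alexanderMinor j f *
          ((MvLaurent.var (D.arcComponent j') : MvLaurent D.Component) - 1)) := fun j' => by
    obtain ⟨f', hr, ε, hε⟩ := D.exists_alexanderMinor_mul_eq j j' f
    refine ⟨f', fun c => ?_, (hu ε).unit, hε⟩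
    rw [Set.range_comp, hr, ← Set.range_comp]
    exact h c
  obtain ⟨f₁, hf₁, ε₁, hm₁⟩ := key j₁
  -- Here t_j - 1 divides the minor times t_{j₁} - 1; as the two components differ, it divides the
  -- minor itself.
  obtain ⟨q, hq⟩ := MvLaurent.var_sub_one_dvd_of_dvd_mul hj
    ((Units.dvd_mul_left (u := ε₁)).1 (hm₁ ▸ dvd_mul_left _ _))
  have hmin : ∀ j' : D.Arc, ∃ f' : {a : D.Arc // a ≠ j'} → X,
      (∀ c, D.alexanderRow c ∈
        Submodule.span (MvLaurent D.Component) (Set.range (D.alexanderRow ∘ f'))) ∧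
      ∃ ε : (MvLaurent D.Component)ˣ, D.alexanderMinor j' f' =
        ε * (q * ((MvLaurent.var (D.arcComponent j') : MvLaurent D.Component) - 1)) := fun j' => by
    obtain ⟨f', hf', ε, hm'⟩ := key j'
    refine ⟨f', hf', ε, mul_right_cancel₀ (hne (D.arcComponent j)) ?_⟩
    rw [hm', hq]
    ring
  refine ⟨q, fun δ => ⟨fun hδ p hp => ?_, fun hδ => ?_⟩, hq⟩
  · refine hδ.trans ?_
    rw [← Ideal.mem_span_singleton]
    refine Ideal.span_le.2 ?_ hp
    rintro _ ⟨j', g, rfl⟩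
    obtain ⟨f', hf', ε, hm'⟩ := hmin j'
    rw [SetLike.mem_coe, Ideal.mem_span_singleton]
    refine dvd_trans ?_ (D.alexanderMinor_dvd f' g hf')
    rw [hm', Units.dvd_mul_left]
    exact dvd_mul_right _ _
  · have hmem : ∀ j' f', D.alexanderMinor j' f' ∈ D.elementaryIdeal := fun j' f' =>
      Ideal.subset_span ⟨j', f', rfl⟩
    obtain ⟨α, hα⟩ := hδ _ (hmem j f)
    obtain ⟨f₂, -, ε₂, hm₂⟩ := hmin j₁
    obtain ⟨β, hβ⟩ := (Units.dvd_mul_left (u := ε₂)).1 (hm₂ ▸ hδ _ (hmem j₁ f₂))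
    rw [hq] at hα
    rcases eq_or_ne δ 0 with rfl | hδ0
    · rw [zero_mul, mul_eq_zero] at hα
      rw [hα.resolve_left (hne _)]
    -- A common divisor δ divides both (t_j - 1) q and (t_{j₁} - 1) q; eliminating q shows that t_j
    -- - 1 divides the cofactor α, so δ divides q.
    have hαβ : α * ((MvLaurent.var (D.arcComponent j₁) : MvLaurent D.Component) - 1) =
        ((MvLaurent.var (D.arcComponent j) : MvLaurent D.Component) - 1) * β := by
      apply mul_left_cancel₀ hδ0
      linear_combination (1 - (MvLaurent.var (D.arcComponent j₁) : MvLaurent D.Component)) * hα +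
        ((MvLaurent.var (D.arcComponent j) : MvLaurent D.Component) - 1) * hβ
    obtain ⟨α', rfl⟩ := MvLaurent.var_sub_one_dvd_of_dvd_mul hj ⟨β, hαβ⟩
    exact ⟨α', mul_left_cancel₀ (hne (D.arcComponent j)) (by rw [hα]; ring)⟩

theorem IsAlexanderPolynomial.associated [Fintype S] {p q : MvLaurent D.Component}
    (hp : D.IsAlexanderPolynomial p) (hq : D.IsAlexanderPolynomial q) : Associated p q :=
  associated_of_dvd_dvd ((hq p).2 ((hp p).1 dvd_rfl)) ((hp q).2 ((hq q).1 dvd_rfl))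

/-- Functions on the arcs are the functions on the segments that satisfy one equation for each
segment not ending in an undercrossing, which gives a dimension of at least the number of crossings.
Equality can fail, since a closed curve may have no undercrossing. -/
theorem card_crossing_le_card_arc [Fintype S] [Fintype X] [Fintype D.Arc] :
    Fintype.card X ≤ Fintype.card D.Arc := by
  classical
  let φ : (S → ℚ) →ₗ[ℚ] ({s // s ∉ Set.range D.underIn} → ℚ) :=
    { toFun := fun g s => g (D.next s.1) - g s.1
      map_add' := fun g h => by ext; simp; ring
      map_smul' := fun c g => by ext; simp; ring }
  let ψ : (D.Arc → ℚ) →ₗ[ℚ] (S → ℚ) := LinearMap.funLeft ℚ ℚ D.arc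
  have hker : LinearMap.ker φ ≤ LinearMap.range ψ := by
    intro g hg
    refine ⟨Quot.lift g ?_, rfl⟩
    rintro s _ ⟨rfl, hs⟩
    exact (sub_eq_zero.1 (congrFun (LinearMap.mem_ker.1 hg) ⟨s, hs⟩)).symm
  have h1 := φ.finrank_range_add_finrank_ker
  have h2 := Submodule.finrank_le (LinearMap.range φ)
  have h3 := Submodule.finrank_mono hker
  have h4 := ψ.finrank_range_le
  have h5 : Fintype.card {s // s ∉ Set.range D.underIn} + Fintype.card X = Fintype.card S := by
    rw [Fintype.card_subtype_compl, Fintype.card_subtype, add_comm]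
    have hinj : Function.Injective D.underIn := fun a b hab => by
      simpa using D.pass_injective (a₁ := Sum.inr a) (a₂ := Sum.inr b) hab
    have : (Finset.univ.filter (fun x => x ∈ Set.range D.underIn)).card = Fintype.card X := by
      rw [← Finset.card_univ, ← Finset.card_image_of_injective _ hinj]
      congr 1
      ext; simp
    rw [this]
    have := Fintype.card_le_of_injective _ hinj
    omega
  simp only [Module.finrank_fintype_fun_eq_card] at h1 h2 h4
  omega

theorem exists_rows [Fintype S] [Fintype X] (j : D.Arc) (c₀ : X) :
    ∃ f : {a : D.Arc // a ≠ j} → X, ∀ c ≠ c₀, c ∈ Set.range f := by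
  classical
  let : Finite D.Arc := inferInstanceAs (Finite (Quot _))
  let : Fintype D.Arc := Fintype.ofFinite _
  have h := D.card_crossing_le_card_arc
  have h1 : Fintype.card {c // c ≠ c₀} ≤ Fintype.card {a : D.Arc // a ≠ j} := by
    simp only [Fintype.card_subtype_compl, Fintype.card_unique, ne_eq]
    omega
  obtain ⟨g⟩ := Function.Embedding.nonempty_of_card_le h1
  -- Surplus indices receive the crossing `c₀`; they occur when there are more arcs than crossings.
  refine ⟨fun a => if h : ∃ c, g c = a then h.choose.1 else c₀, fun c hc => ⟨g ⟨c, hc⟩, ?_⟩⟩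
  have hex : ∃ c', g c' = g ⟨c, hc⟩ := ⟨_, rfl⟩
  change (if h : ∃ c', g c' = g ⟨c, hc⟩ then h.choose.1 else c₀) = c
  rw [dif_pos hex, g.injective hex.choose_spec]

end LinkDiagram

/-! ### Alexander numberings and the redundancy of one Wirtinger relator. -/

namespace LinkDiagram

variable {S X : Type*} (D : LinkDiagram S X)

/-- A labelling of the segments by exponents of monomials, such as the one given by the Alexander
numbering of the region to the right of a segment. -/
structure IsNumbering (lab : S → D.Component →₀ ℤ) : Prop where
  join : ∀ s, s ∉ Set.range (Sum.elim D.overIn D.underIn) → lab (D.next s) = lab s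
  pos : ∀ c, D.sign c = 1 →
    lab (D.overIn c) = lab (D.underIn c) + Finsupp.single (D.component (D.underIn c)) 1 ∧
    lab (D.next (D.overIn c)) = lab (D.underIn c) ∧
    lab (D.next (D.underIn c)) =
      lab (D.underIn c) + Finsupp.single (D.component (D.overIn c)) 1
  neg : ∀ c, D.sign c ≠ 1 →
    lab (D.underIn c) =
      lab (D.next (D.underIn c)) + Finsupp.single (D.component (D.overIn c)) 1 ∧
    lab (D.overIn c) = lab (D.next (D.underIn c)) ∧
    lab (D.next (D.overIn c)) =
      lab (D.next (D.underIn c)) + Finsupp.single (D.component (D.underIn c)) 1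

/-- Put β(s) = t^{lab s} times the basis vector of the arc of s. The sum of β(s) - β(next s) over
all segments telescopes to zero. Segments not ending at a crossing contribute nothing, and the two
that end at a crossing contribute a unit multiple of its row. -/
theorem IsNumbering.exists_relation [Fintype S] [Fintype X] {lab : S → D.Component →₀ ℤ}
    (h : D.IsNumbering lab) :
    ∃ u : X → (MvLaurent D.Component)ˣ,
      ∑ c, (u c : MvLaurent D.Component) • D.alexanderRow c = 0 := by
  classical
  let β : S → D.Arc → MvLaurent D.Component := fun s =>
    (MvLaurent.monomial (lab s) : MvLaurent D.Component) • Pi.single (D.arc s) 1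
  have hinj := D.pass_injective
  have hover : ∀ c, D.arc (D.next (D.overIn c)) = D.arc (D.overIn c) := fun c =>
    D.arc_next fun ⟨c', hc'⟩ => by
      simpa using @hinj (Sum.inr c') (Sum.inl c) hc'
  have htot : ∑ s, (β s - β (D.next s)) = 0 := by
    rw [Finset.sum_sub_distrib, sub_eq_zero]
    exact (Equiv.sum_comp (Equiv.ofBijective _
      (Finite.injective_iff_bijective.1 D.next_injective)) β).symm
  have hsum : ∑ x : X ⊕ X, (β (Sum.elim D.overIn D.underIn x) -
      β (D.next (Sum.elim D.overIn D.underIn x))) = 0 := by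
    rw [← htot, ← Finset.sum_image (s := Finset.univ) (g := Sum.elim D.overIn D.underIn)
      (f := fun s => β s - β (D.next s)) fun _ _ _ _ h => hinj h]
    apply Finset.sum_subset (Finset.subset_univ _)
    intro s _ hs
    have hs' : s ∉ Set.range (Sum.elim D.overIn D.underIn) := by simpa using hs
    have hu : s ∉ Set.range D.underIn := fun ⟨c, hc⟩ => hs' ⟨Sum.inr c, hc⟩
    simp only [β, h.join s hs', D.arc_next hu, sub_self]
  rw [Fintype.sum_sum_type, ← Finset.sum_add_distrib] at hsum
  refine ⟨fun c => if D.sign c = 1 then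
    MvLaurent.monomial (lab (D.underIn c)) * MvLaurent.var (D.component (D.overIn c))
    else MvLaurent.monomial (lab (D.next (D.underIn c))), ?_⟩
  rw [← hsum]
  apply Finset.sum_congr rfl
  intro c _
  funext j
  have hrow := congrFun (D.alexanderMatrix_row c) j
  have hs : (MvLaurent.var (D.component (D.overIn c)) : MvLaurent D.Component) *
    ((MvLaurent.var (D.component (D.overIn c)))⁻¹ : (MvLaurent D.Component)ˣ) = 1 :=
    Units.mul_inv _
  simp only [Pi.smul_apply, alexanderRow, smul_eq_mul]
  rw [hrow]
  simp only [Sum.elim_inl, Sum.elim_inr, β, Pi.add_apply, Pi.sub_apply, Pi.smul_apply,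
    smul_eq_mul, hover]
  split_ifs with hc
  · obtain ⟨h1, h2, h3⟩ := h.pos c hc
    simp only [h1, h2, h3, MvLaurent.monomial_add, MvLaurent.monomial_single, Units.val_mul,
      Pi.add_apply, Pi.sub_apply, Pi.smul_apply, smul_eq_mul]
    linear_combination (MvLaurent.monomial (lab (D.underIn c)) : MvLaurent D.Component) *
      (((MvLaurent.var (D.component (D.underIn c)) : MvLaurent D.Component) - 1) *
        (Pi.single (D.arc (D.overIn c)) 1 : D.Arc → MvLaurent D.Component) j +
        (Pi.single (D.arc (D.underIn c)) 1 : D.Arc → MvLaurent D.Component) j) * hs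
  · obtain ⟨h1, h2, h3⟩ := h.neg c hc
    simp only [h1, h2, h3, MvLaurent.monomial_add, MvLaurent.monomial_single, Units.val_mul,
      Pi.add_apply, Pi.sub_apply, Pi.smul_apply, smul_eq_mul]
    ring

/-- The relation has unit coefficients, so it can be solved for the omitted row. -/
theorem IsNumbering.row_mem_span [Fintype S] [Fintype X] {lab : S → D.Component →₀ ℤ}
    (h : D.IsNumbering lab) {ι : Type*} {f : ι → X} {c₀ : X} (hf : ∀ c ≠ c₀, c ∈ Set.range f)
    (c : X) : D.alexanderRow c ∈
      Submodule.span (MvLaurent D.Component) (Set.range (D.alexanderRow ∘ f)) := by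
  classical
  have hmem : ∀ c ≠ c₀, D.alexanderRow c ∈
      Submodule.span (MvLaurent D.Component) (Set.range (D.alexanderRow ∘ f)) := fun c hc => by
    obtain ⟨a, rfl⟩ := hf c hc
    exact Submodule.subset_span ⟨a, rfl⟩
  rcases eq_or_ne c c₀ with rfl | hc
  · obtain ⟨u, hu⟩ := h.exists_relation
    rw [← Finset.add_sum_erase _ _ (Finset.mem_univ c), add_eq_zero_iff_eq_neg] at hu
    have : D.alexanderRow c = ((u c)⁻¹ : (MvLaurent D.Component)ˣ) •
        ((u c : MvLaurent D.Component) • D.alexanderRow c) := by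
      rw [Units.smul_def, smul_smul, Units.inv_mul, one_smul]
    rw [this, hu]
    refine Submodule.smul_mem _ _ (Submodule.neg_mem _ (Submodule.sum_mem _ fun c' hc' =>
      Submodule.smul_mem _ _ (hmem c' (Finset.ne_of_mem_erase hc'))))
  · exact hmem c hc

end LinkDiagram

/-- The image Q of N modulo B is divisible and finitely generated. Nakayama's lemma for the ideal
(2) yields an odd r that kills Q; since r is nonzero, divisibility gives Q = rQ = 0. -/
theorem Submodule.le_of_forall_prime_le_sup {M : Type*} [AddCommGroup M] {N B : Submodule ℤ M}
    (hN : N.FG) (h : ∀ p : ℕ, p.Prime → ∀ z ∈ N, ∃ b ∈ B, ∃ z' ∈ N, z = b + (p : ℤ) • z') :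
    N ≤ B := by
  let Q := N.map B.mkQ
  have hp : ∀ p : ℕ, p.Prime → ∀ x ∈ Q, ∃ y ∈ Q, x = (p : ℤ) • y := by
    rintro p hp _ ⟨z, hz, rfl⟩
    obtain ⟨b, hb, z', hz', rfl⟩ := h p hp z hz
    refine ⟨_, ⟨z', hz', rfl⟩, ?_⟩
    rw [map_add, map_smul, B.mkQ_apply b, (Submodule.Quotient.mk_eq_zero B).2 hb, zero_add]
  have hn : ∀ n : ℕ, n ≠ 0 → ∀ x ∈ Q, ∃ y ∈ Q, x = (n : ℤ) • y := by
    intro n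
    induction n using Nat.recOnMul with
    | zero => intro h; exact absurd rfl h
    | one => exact fun _ x hx => ⟨x, hx, by simp⟩
    | prime p h => exact fun _ => hp p h
    | mul a b ha hb =>
      intro hab x hx
      obtain ⟨y, hy, rfl⟩ := ha (left_ne_zero_of_mul hab) x hx
      obtain ⟨z, hz, rfl⟩ := hb (right_ne_zero_of_mul hab) y hy
      exact ⟨z, hz, by rw [smul_smul, Nat.cast_mul]⟩
  obtain ⟨r, hr, hrQ⟩ := Submodule.exists_sub_one_mem_and_smul_eq_zero_of_fg_of_le_smul
    (Ideal.span {(2 : ℤ)}) Q (hN.map _) fun x hx => by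
      obtain ⟨y, hy, rfl⟩ := hp 2 Nat.prime_two x hx
      exact Submodule.smul_mem_smul (Ideal.subset_span rfl) hy
  have hr0 : r ≠ 0 := by
    rintro rfl
    rw [Ideal.mem_span_singleton] at hr
    norm_num at hr
  intro z hz
  obtain ⟨y, hy, hy'⟩ := hn r.natAbs (Int.natAbs_ne_zero.2 hr0) _ ⟨z, hz, rfl⟩
  rw [← Submodule.Quotient.mk_eq_zero, ← Submodule.mkQ_apply, hy']
  rcases Int.natAbs_eq r with h | h
  · rw [← h, hrQ y hy]
  · rw [show ((r.natAbs : ℤ)) = -r by omega, neg_smul, hrQ y hy, neg_zero]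

/-! ### Vanishing of the first cohomology of the sphere. -/

namespace PeriodicGraph

variable {V E : Type*} (G : PeriodicGraph V E)

theorem exists_start_eq (v : V) : ∃ d, G.start d = v := by
  obtain ⟨e, h | h⟩ := G.not_isolated v
  · exact ⟨(e, true), h⟩
  · exact ⟨(e, false), h⟩

theorem apply_eq_of_component_eq {Z : Type*} {w : V → Z} (hw : ∀ e, w (G.src e) = w (G.tgt e))
    {u v : V} (h : G.quotientGraph.connectedComponentMk u = G.quotientGraph.connectedComponentMk v) :
    w u = w v := by
  obtain ⟨p⟩ := SimpleGraph.ConnectedComponent.exact h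
  induction p with
  | nil => rfl
  | cons hadj _ ih =>
    rw [← ih (SimpleGraph.ConnectedComponent.sound ⟨by assumption⟩)]
    rw [quotientGraph, SimpleGraph.fromRel_adj] at hadj
    obtain ⟨-, ⟨e, rfl, rfl⟩ | ⟨e, rfl, rfl⟩⟩ := hadj
    · exact hw e
    · exact (hw e).symm

end PeriodicGraph

namespace AnnularEmbedding

variable {V E R : Type*} [Fintype V] [Fintype E] [Fintype R] {G : PeriodicGraph V E}
  (P : AnnularEmbedding G R)

theorem induction_of_connected {p : V ⊕ R → Prop} {x₀ : V ⊕ R} (h₀ : p x₀)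
    (h : ∀ d, p (Sum.inl (G.start d)) ↔ p (Sum.inr (P.left d))) (x : V ⊕ R) : p x := by
  obtain ⟨q⟩ := P.connected.preconnected x₀ x
  induction q with
  | nil => exact h₀
  | cons hadj _ ih =>
    apply ih
    rw [SimpleGraph.fromRel_adj] at hadj
    obtain ⟨-, ⟨d, rfl, rfl⟩ | ⟨d, rfl, rfl⟩⟩ := hadj
    · exact (h d).1 h₀
    · exact (h d).2 h₀

theorem left_rot_symm (d : E × Bool) : P.left (P.rot.symm d) = P.left (Dart.rev d) := by
  simpa using P.left_corner (P.rot.symm d)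

theorem start_rot_symm (d : E × Bool) : G.start (P.rot.symm d) = G.start d := by
  simpa using (P.start_rot (P.rot.symm d)).symm

theorem apply_eq_of_rot {Z : Type*} {y : E × Bool → Z} (hy : ∀ d, y (P.rot d) = y d)
    {d d' : E × Bool} (h : G.start d = G.start d') : y d = y d' := by
  obtain ⟨n, rfl⟩ := (P.sameCycle_rot d d' h).exists_nat_pow_eq
  clear h
  induction n with
  | zero => rfl
  | succ n ih => rw [pow_succ', Equiv.Perm.mul_apply, hy, ih]

def revEquiv (E : Type*) : (E × Bool) ≃ (E × Bool) where
  toFun := Dart.rev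
  invFun := Dart.rev
  left_inv := Dart.rev_rev
  right_inv := Dart.rev_rev

section Chains

variable (k : Type*) [CommRing k]

open Classical in
/-- The boundary map of the incidence graph of vertices and regions, whose edges are the corners. -/
def boundary : (E × Bool → k) →ₗ[k] (V → k) × (R → k) where
  toFun z := (fun v => ∑ d, if G.start d = v then z d else 0,
    fun r => ∑ d, if P.left d = r then z d else 0)
  map_add' z z' := by
    ext <;> simp [← Finset.sum_add_distrib, ← ite_add_zero]
  map_smul' a z := by
    ext <;> simp [Finset.mul_sum]

/-- The boundary map of the quadrilaterals around the edges. -/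
def quadBoundary : (E → k) →ₗ[k] (E × Bool → k) where
  toFun y d := y d.1 - y (P.rot d).1
  map_add' y y' := by ext; simp; ring
  map_smul' a y := by ext; simp; ring

/-- `rot` permutes the corners at a vertex, and `d ↦ rev (rot d)` permutes those in a region; both
carry the first term of `quadBoundary` to the second. -/
theorem boundary_quadBoundary (y : E → k) : P.boundary k (P.quadBoundary k y) = 0 := by
  classical
  have h1 : ∀ v, ∑ d, (if G.start d = v then y d.1 else 0) =
      ∑ d, if G.start d = v then y (P.rot d).1 else 0 := fun v => by
    rw [← Equiv.sum_comp P.rot]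
    simp only [P.start_rot]
  have h2 : ∀ r, ∑ d, (if P.left d = r then y d.1 else 0) =
      ∑ d, if P.left d = r then y (P.rot d).1 else 0 := fun r => by
    rw [← Equiv.sum_comp (P.rot.trans (revEquiv E))]
    have h : ∀ d, P.left ((P.rot.trans (revEquiv E)) d) = P.left d := fun d =>
      (P.left_corner d).symm
    simp only [h]
    rfl
  have h3 : ∀ (p : Prop) [Decidable p] (a b : k),
      (if p then a - b else 0) = (if p then a else 0) - if p then b else 0 := by
    intros; split_ifs <;> simp
  ext i
  · simp only [boundary, quadBoundary, LinearMap.coe_mk, AddHom.coe_mk, h3,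
      Finset.sum_sub_distrib]
    exact sub_eq_zero.2 (h1 i)
  · simp only [boundary, quadBoundary, LinearMap.coe_mk, AddHom.coe_mk, h3,
      Finset.sum_sub_distrib]
    exact sub_eq_zero.2 (h2 i)

open Classical in
theorem boundary_single (d : E × Bool) (a : k) : P.boundary k (Pi.single d a) =
    (Pi.single (G.start d) a, Pi.single (P.left d) a) := by
  have h3 : ∀ (p q : Prop) [Decidable p] [Decidable q] (a : k),
      (if p then (if q then a else 0) else 0) = if q then (if p then a else 0) else 0 := by
    intros; split_ifs <;> simp
  ext i <;>
  simp only [boundary, LinearMap.coe_mk, AddHom.coe_mk, Pi.single_apply, h3,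
    Finset.sum_ite_eq, Finset.mem_univ, if_true, eq_comm]

end Chains

/-- An edge function in the kernel is constant around each vertex, hence on each component of the
graph. -/
theorem finrank_ker_quadBoundary_le (k : Type*) [Field k] :
    Module.finrank k (LinearMap.ker (P.quadBoundary k)) ≤
      Nat.card G.quotientGraph.ConnectedComponent := by
  classical
  let : Fintype G.quotientGraph.ConnectedComponent := Fintype.ofFinite _
  let ψ : (G.quotientGraph.ConnectedComponent → k) →ₗ[k] (E → k) :=
    LinearMap.funLeft k k fun e => G.quotientGraph.connectedComponentMk (G.src e)
  have hle : LinearMap.ker (P.quadBoundary k) ≤ LinearMap.range ψ := by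
    intro y hy
    have hrot : ∀ d, y (P.rot d).1 = y d.1 := fun d =>
      (sub_eq_zero.1 (congrFun (LinearMap.mem_ker.1 hy) d)).symm
    have hstart : ∀ d d', G.start d = G.start d' → y d.1 = y d'.1 := fun d d' h =>
      P.apply_eq_of_rot (y := fun d => y d.1) hrot h
    choose δ hδ using G.exists_start_eq
    have hw : ∀ e, y (δ (G.src e)).1 = y (δ (G.tgt e)).1 := fun e =>
      (hstart _ (e, true) (hδ _)).trans (hstart _ (e, false) (hδ _)).symm
    refine ⟨fun C => y (δ C.out).1, ?_⟩
    ext e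
    have := G.apply_eq_of_component_eq (w := fun v => y (δ v).1) hw
      (u := (G.quotientGraph.connectedComponentMk (G.src e)).out) (v := G.src e)
      (Quot.out_eq _)
    exact this.trans (hstart _ (e, true) (hδ _))
  calc _ ≤ _ := Submodule.finrank_mono hle
    _ ≤ _ := ψ.finrank_range_le
    _ = _ := by rw [Module.finrank_fintype_fun_eq_card, Nat.card_eq_fintype_card]

/-- The incidence graph is connected, so the boundaries of the corners and one basis vector span
everything. -/
theorem card_le_finrank_range_boundary (k : Type*) [Field k] :
    Fintype.card V + Fintype.card R ≤
      Module.finrank k (LinearMap.range (P.boundary k)) + 1 := by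
  classical
  let x₀ : (V → k) × (R → k) := (0, Pi.single (P.path 0) 1)
  let S := LinearMap.range (P.boundary k) ⊔ Submodule.span k {x₀}
  have hd : ∀ d, ((Pi.single (G.start d) 1, 0) : (V → k) × (R → k)) +
      (0, Pi.single (P.left d) 1) ∈ S := fun d => by
    refine Submodule.mem_sup_left ⟨Pi.single d 1, ?_⟩
    rw [boundary_single]
    simp
  have hall := P.induction_of_connected (x₀ := Sum.inr (P.path 0))
    (p := Sum.elim (fun v => ((Pi.single v 1, 0) : (V → k) × (R → k)) ∈ S)
      fun r => ((0, Pi.single r 1) : (V → k) × (R → k)) ∈ S)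
    (Submodule.mem_sup_right (Submodule.subset_span rfl))
    fun d => ⟨fun h => (Submodule.add_mem_iff_right _ h).1 (hd d),
      fun h => (Submodule.add_mem_iff_left _ h).1 (hd d)⟩
  have htop : S = ⊤ := by
    rw [eq_top_iff]
    rintro ⟨f, g⟩ -
    have : ((f, g) : (V → k) × (R → k)) =
        ∑ v, f v • ((Pi.single v 1, 0) : (V → k) × (R → k)) +
        ∑ r, g r • ((0, Pi.single r 1) : (V → k) × (R → k)) := by
      ext i <;> simp [Prod.fst_sum, Prod.snd_sum, Finset.sum_apply, Pi.single_apply]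
    rw [this]
    exact Submodule.add_mem _
      (Submodule.sum_mem _ fun v _ => Submodule.smul_mem _ _ (hall (Sum.inl v)))
      (Submodule.sum_mem _ fun r _ => Submodule.smul_mem _ _ (hall (Sum.inr r)))
  have h1 := Submodule.finrank_add_le_finrank_add_finrank (LinearMap.range (P.boundary k))
    (Submodule.span k {x₀})
  have h2 : Module.finrank k (Submodule.span k {x₀}) ≤ 1 := by
    simpa using finrank_span_le_card (R := k) {x₀}
  have h3 : Module.finrank k S = Fintype.card V + Fintype.card R := by
    rw [htop, finrank_top, Module.finrank_prod, Module.finrank_fintype_fun_eq_card,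
      Module.finrank_fintype_fun_eq_card]
  change Module.finrank k S ≤ _ at h1
  omega

/-- One inclusion is `boundary_quadBoundary`. With the two rank estimates, Euler's formula forces
equality of dimensions. -/
theorem ker_boundary_field (k : Type*) [Field k] :
    LinearMap.ker (P.boundary k) = LinearMap.range (P.quadBoundary k) := by
  symm
  apply Submodule.eq_of_le_of_finrank_le
  · rintro _ ⟨y, rfl⟩
    exact P.boundary_quadBoundary k y
  · have h1 := P.finrank_ker_quadBoundary_le k
    have h2 := P.card_le_finrank_range_boundary k
    have h3 := (P.boundary k).finrank_range_add_finrank_ker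
    have h4 := (P.quadBoundary k).finrank_range_add_finrank_ker
    have h5 := P.euler
    simp only [Module.finrank_fintype_fun_eq_card, Fintype.card_prod, Fintype.card_bool] at h3 h4
    omega

theorem boundary_map {k k' : Type*} [CommRing k] [CommRing k'] (f : k →+* k') (z : E × Bool → k) :
    P.boundary k' (f ∘ z) = (f ∘ (P.boundary k z).1, f ∘ (P.boundary k z).2) := by
  ext i <;> simp [boundary, apply_ite f]

/-- A cycle is a boundary modulo every prime p. The remainder is p times a chain, which is again a
cycle as there is no torsion, so the divisibility criterion applies. -/
theorem ker_boundary_le : LinearMap.ker (P.boundary ℤ) ≤ LinearMap.range (P.quadBoundary ℤ) := by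
  apply Submodule.le_of_forall_prime_le_sup (IsNoetherian.noetherian _)
  intro p hp z hz
  have : Fact p.Prime := ⟨hp⟩
  have hz' : (Int.castRingHom (ZMod p)) ∘ z ∈ LinearMap.ker (P.boundary (ZMod p)) := by
    rw [LinearMap.mem_ker, boundary_map, LinearMap.mem_ker.1 hz]
    ext <;> simp
  rw [ker_boundary_field] at hz'
  obtain ⟨y, hy⟩ := hz'
  choose y' hy' using fun e => ZMod.intCast_surjective (y e)
  have hdvd : ∀ d, (p : ℤ) ∣ z d - P.quadBoundary ℤ y' d := fun d => by
    rw [← ZMod.intCast_zmod_eq_zero_iff_dvd]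
    have := congrFun hy d
    simp only [quadBoundary, LinearMap.coe_mk, AddHom.coe_mk, Function.comp_apply,
      Int.coe_castRingHom] at this ⊢
    push_cast
    rw [hy', hy', this, sub_self]
  choose z' hz' using hdvd
  have hzz : z = P.quadBoundary ℤ y' + (p : ℤ) • z' := by
    ext d
    simp [← hz' d]
  refine ⟨_, ⟨y', rfl⟩, z', ?_, hzz⟩
  have hp0 : (p : ℤ) ≠ 0 := by exact_mod_cast hp.ne_zero
  rw [hzz, LinearMap.mem_ker, map_add, boundary_quadBoundary, zero_add, map_smul] at hz
  exact (smul_eq_zero.1 hz).resolve_left hp0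

/-- Vanishing of the first cohomology of the sphere: a function on the corners that is balanced
around every edge is a sum of a function of the vertex and a function of the region. -/
theorem exists_potential {W : Type*} [AddCommGroup W] (c : E × Bool → W)
    (hc : ∀ e, c (e, true) + c (e, false) =
      c (P.rot.symm (e, true)) + c (P.rot.symm (e, false))) :
    ∃ (w : V → W) (u : R → W), ∀ d, c d = w (G.start d) + u (P.left d) := by
  classical
  let pair : (E × Bool → ℤ) →ₗ[ℤ] W :=
    { toFun := fun z => ∑ d, z d • c d
      map_add' := fun z z' => by simp [add_smul, Finset.sum_add_distrib]
      map_smul' := fun a z => by simp [mul_smul, Finset.smul_sum] }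
  have hpair : ∀ d, pair (Pi.single d 1) = c d := fun d => by
    simp [pair, Pi.single_apply, ite_smul]
  have hker : ∀ z, P.boundary ℤ z = 0 → pair z = 0 := by
    intro z hz
    obtain ⟨y, rfl⟩ := P.ker_boundary_le hz
    have h1 : ∑ d, y (P.rot d).1 • c d = ∑ d, y d.1 • c (P.rot.symm d) := by
      rw [← Equiv.sum_comp P.rot fun d : E × Bool => y d.1 • c (P.rot.symm d)]
      simp
    change ∑ d : E × Bool, (y d.1 - y (P.rot d).1) • c d = 0
    simp only [sub_smul, Finset.sum_sub_distrib, h1]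
    rw [← Finset.sum_sub_distrib, Fintype.sum_prod_type]
    apply Finset.sum_eq_zero
    intro e _
    simp only [Fintype.sum_bool, ← smul_sub]
    rw [← smul_add, sub_add_sub_comm, hc, sub_self, smul_zero]
  -- Chains from the base region `path 0`. The boundary map is unsigned, so a vertex is reached with
  -- a sum of endpoints and a region with a difference; the potentials are the values of `c` on
  -- these chains.
  have hpath := P.induction_of_connected (x₀ := Sum.inr (P.path 0))
    (p := Sum.elim (fun v => ∃ z, P.boundary ℤ z = (Pi.single v 1, Pi.single (P.path 0) 1))
      fun r => ∃ z, P.boundary ℤ z = (0, Pi.single r 1 - Pi.single (P.path 0) 1))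
    ⟨0, by simp; rfl⟩ fun d => by
      have hd := P.boundary_single ℤ d 1
      constructor
      · rintro ⟨z, hz⟩
        exact ⟨Pi.single d 1 - z, by rw [map_sub, hd, hz]; ext <;> simp⟩
      · rintro ⟨z, hz⟩
        exact ⟨Pi.single d 1 - z, by rw [map_sub, hd, hz]; ext <;> simp⟩
  choose zV hV using fun v => hpath (Sum.inl v)
  choose zR hR using fun r => hpath (Sum.inr r)
  refine ⟨fun v => pair (zV v), fun r => pair (zR r), fun d => ?_⟩
  rw [← hpair, ← map_add, ← sub_eq_zero, ← map_sub]
  apply hker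
  rw [map_sub, map_add, boundary_single, hV, hR]
  ext <;> simp

end AnnularEmbedding

/-! ### The diagram of the encircled link and its Alexander numbering. -/

namespace AnnularEmbedding

variable {V E R : Type*} [Fintype V] [Fintype E] [Fintype R] {G : PeriodicGraph V E}
  {P : AnnularEmbedding G R} (o : P.Orientation)

theorem encircledLink_next : (encircledLink o).next = nextSegment o := rfl
theorem encircledLink_overIn : (encircledLink o).overIn = overSegment o := rfl
theorem encircledLink_underIn : (encircledLink o).underIn = underSegment o := rfl
theorem encircledLink_sign : (encircledLink o).sign = crossingSign o := rfl

variable {o}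

theorem next_strand_of_dir {d : E × Bool} (h : o.dir d = true) :
    nextSegment o (.strand d 0) = .strand d 1 ∧ nextSegment o (.strand d 1) = .strand d 2 ∧
    nextSegment o (.strand d 2) = .strand d 3 ∧ nextSegment o (.strand d 3) = .strand d 4 ∧
    nextSegment o (.strand d 4) = .strand (P.rot.symm (Dart.rev (P.rot d))) 4 := by
  simp [nextSegment, h]

theorem next_strand_of_not_dir {d : E × Bool} (h : o.dir d = false) :
    nextSegment o (.strand d 4) = .strand d 3 ∧ nextSegment o (.strand d 3) = .strand d 2 ∧
    nextSegment o (.strand d 2) = .strand d 1 ∧ nextSegment o (.strand d 1) = .strand d 0 ∧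
    nextSegment o (.strand d 0) = .strand (Dart.rev d) 0 := by
  simp [nextSegment, h]

variable (o)

theorem dir_rot_symm_rev_rot (d : E × Bool) :
    o.dir (P.rot.symm (Dart.rev (P.rot d))) = !o.dir d := by
  simpa using o.dir_second (P.rot d)

/-- The component of the strand of a corner. -/
def strandComponent (d : E × Bool) : (encircledLink o).Component :=
  (encircledLink o).component (.strand d 0)

theorem component_next' (s : P.Segment) :
    (encircledLink o).component (nextSegment o s) = (encircledLink o).component s :=
  (encircledLink o).component_next s

theorem component_strand (d : E × Bool) (j : Fin 5) :
    (encircledLink o).component (.strand d j) = strandComponent o d := by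
  have key : (encircledLink o).component (.strand d 1) = (encircledLink o).component (.strand d 0) ∧
      (encircledLink o).component (.strand d 2) = (encircledLink o).component (.strand d 1) ∧
      (encircledLink o).component (.strand d 3) = (encircledLink o).component (.strand d 2) ∧
      (encircledLink o).component (.strand d 4) = (encircledLink o).component (.strand d 3) := by
    cases h : o.dir d
    · obtain ⟨h4, h3, h2, h1, -⟩ := next_strand_of_not_dir h
      rw [← h1, ← h2, ← h3, ← h4]
      simp only [component_next', and_self]
    · obtain ⟨h1, h2, h3, h4, -⟩ := next_strand_of_dir h
      rw [← h4, ← h3, ← h2, ← h1]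
      simp only [component_next', and_self]
  obtain ⟨h1, h2, h3, h4⟩ := key
  fin_cases j
  · rfl
  · exact h1
  · exact h2.trans h1
  · exact h3.trans (h2.trans h1)
  · exact h4.trans (h3.trans (h2.trans h1))

theorem strandComponent_rev (d : E × Bool) :
    strandComponent o (Dart.rev d) = strandComponent o d := by
  have key : ∀ d, o.dir d = false → strandComponent o (Dart.rev d) = strandComponent o d :=
    fun d h => by
      rw [strandComponent, ← (next_strand_of_not_dir h).2.2.2.2, component_next']
      rfl
  cases h : o.dir d
  · exact key d h
  · have := key (Dart.rev d) (by rw [o.dir_first, h]; rfl)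
    rw [Dart.rev_rev] at this
    exact this.symm

theorem strandComponent_rot_symm_rev (d : E × Bool) :
    strandComponent o (P.rot.symm (Dart.rev d)) = strandComponent o (P.rot.symm d) := by
  have key : ∀ d, o.dir (P.rot.symm d) = true →
      strandComponent o (P.rot.symm (Dart.rev d)) = strandComponent o (P.rot.symm d) :=
    fun d h => by
      have := (next_strand_of_dir h).2.2.2.2
      rw [Equiv.apply_symm_apply] at this
      rw [← component_strand o _ 4, ← this, component_next', component_strand]
  cases h : o.dir (P.rot.symm d)
  · have := key (Dart.rev d) (by rw [o.dir_second, h]; rfl)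
    rw [Dart.rev_rev] at this
    exact this.symm
  · exact key d h

theorem component_front (j : Fin (2 * P.k + 1)) :
    (encircledLink o).component (.front j) = circle o := by
  obtain ⟨j, hj⟩ := j
  induction j with
  | zero => rfl
  | succ j ih =>
    rw [← ih (by omega), ← component_next' o (.front ⟨j, _⟩)]
    simp [nextSegment, show j < 2 * P.k by omega]

theorem component_back (j : Fin (2 * P.k + 1)) :
    (encircledLink o).component (.back j) = circle o := by
  obtain ⟨j, hj⟩ := j
  induction j with
  | zero =>
    rw [← component_front o ⟨0, hj⟩, ← component_next' o (.back _)]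
    simp [nextSegment]
  | succ j ih =>
    rw [← ih (by omega), ← component_next' o (.back ⟨j + 1, _⟩)]
    simp [nextSegment]

/-- Being a strand of the medial link is invariant under `nextSegment`. -/
theorem strandComponent_ne_circle (d : E × Bool) : strandComponent o d ≠ circle o := by
  intro h
  let isStrand : P.Segment → Prop
    | .strand _ _ => True
    | .front _ => False
    | .back _ => False
  have hs : ∀ s s' : P.Segment, (encircledLink o).next s = s' → isStrand s = isStrand s' := by
    rintro (⟨d, j⟩ | j | j) _ rfl <;> simp only [encircledLink_next, nextSegment] <;>
      split_ifs <;> rfl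
  have := congrArg (Quot.lift isStrand hs) h
  exact this.mp trivial

variable {o}

theorem firstIn_of_not_dir {d : E × Bool} (h : o.dir d = false) :
    firstIn o d.1 = .strand d 0 := by
  have h2 := o.dir_first d
  rcases d with ⟨e, _ | _⟩ <;> simp_all [firstIn, Dart.rev]

theorem secondIn_of_dir {d : E × Bool} (h : o.dir d = true) :
    secondIn o (P.rot d).1 = .strand d 4 := by
  have h2 := dir_rot_symm_rev_rot o d
  have h3 : P.rot.symm (P.rot d) = d := P.rot.symm_apply_apply d
  generalize P.rot d = d' at *
  rcases d' with ⟨e, _ | _⟩ <;> simp_all [secondIn, Dart.rev]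

variable (o)

/-- The two strands at the crossing in the middle of an edge. -/
theorem exists_strands (e : E) : ∃ d₁ d₂, d₁.1 = e ∧ o.dir d₁ = false ∧ o.dir d₂ = true ∧
    firstIn o e = .strand d₁ 0 ∧ secondIn o e = .strand d₂ 4 ∧
    ((P.rot d₂ = d₁ ∧ crossingSign o (.edge e) = G.sign e) ∨
      (P.rot d₂ = Dart.rev d₁ ∧ crossingSign o (.edge e) = -G.sign e)) := by
  have h1 := o.dir_first (e, true)
  have h2 := o.dir_second (e, true)
  have hr : Dart.rev (e, true) = (e, false) := rfl
  have hr' : Dart.rev (e, false) = (e, true) := rfl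
  rw [hr] at h1 h2
  cases h : o.dir (e, true) <;> cases h' : o.dir (P.rot.symm (e, true)) <;>
    rw [h] at h1 <;> rw [h'] at h2
  · exact ⟨(e, true), P.rot.symm (e, false), rfl, h, h2, by simp [firstIn, h],
      by simp [secondIn, h'], Or.inr ⟨by simp [hr], by simp [crossingSign, h, h']⟩⟩
  · exact ⟨(e, true), P.rot.symm (e, true), rfl, h, h', by simp [firstIn, h],
      by simp [secondIn, h'], Or.inl ⟨by simp, by simp [crossingSign, h, h']⟩⟩
  · exact ⟨(e, false), P.rot.symm (e, false), rfl, h1, h2, by simp [firstIn, h],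
      by simp [secondIn, h'], Or.inl ⟨by simp, by simp [crossingSign, h, h']⟩⟩
  · exact ⟨(e, false), P.rot.symm (e, true), rfl, h1, h', by simp [firstIn, h],
      by simp [secondIn, h'], Or.inr ⟨by simp [hr'], by simp [crossingSign, h, h']⟩⟩

/-- Values at the pieces into which `γ` is cut by the strands: regions and vertices in turn. -/
def alongPath {Z : Type*} (r : R → Z) (v : V → Z) (j : Fin (2 * P.k + 1)) : Z :=
  if h : (j : ℕ) % 2 = 0 then r (P.path ⟨j / 2, by omega⟩)
  else v (G.start (P.cut ⟨j / 2, by omega⟩))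

theorem alongPath_even {Z : Type*} (r : R → Z) (v : V → Z) {i : ℕ} (hi : 2 * i < 2 * P.k + 1) :
    alongPath (P := P) r v ⟨2 * i, hi⟩ = r (P.path ⟨i, by omega⟩) := by
  simp [alongPath]

theorem alongPath_odd {Z : Type*} (r : R → Z) (v : V → Z) {i : ℕ} (hi : 2 * i + 1 < 2 * P.k + 1) :
    alongPath (P := P) r v ⟨2 * i + 1, hi⟩ = v (G.start (P.cut ⟨i, by omega⟩)) := by
  have h1 : (2 * i + 1) / 2 = i := by omega
  simp [alongPath, h1]

open Classical in
/-- The Alexander numbering of the diagram of the encircled link. -/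
def numbering (PV : V → (encircledLink o).Component →₀ ℤ)
    (PR : R → (encircledLink o).Component →₀ ℤ) : P.Segment → (encircledLink o).Component →₀ ℤ
  | .strand d j => (if o.dir d then PR (P.left d) else PV (G.start d)) +
      if (j = 1 ∧ d ∈ Set.range P.cut) ∨ (j = 3 ∧ P.rot d ∈ Set.range P.cut) then
        Finsupp.single (circle o) 1 else 0
  | .front j => alongPath PR PV j
  | .back j => alongPath PR PV j

theorem edge_mem_range (e : E) :
    firstIn o e ∈ Set.range (Sum.elim (overSegment o) (underSegment o)) ∧
    secondIn o e ∈ Set.range (Sum.elim (overSegment o) (underSegment o)) := by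
  by_cases h : G.sign e = 1
  · exact ⟨⟨Sum.inl (.edge e), by simp [overSegment, h]⟩,
      ⟨Sum.inr (.edge e), by simp [underSegment, h]⟩⟩
  · exact ⟨⟨Sum.inr (.edge e), by simp [underSegment, h]⟩,
      ⟨Sum.inl (.edge e), by simp [overSegment, h]⟩⟩

theorem numbering_join (PV : V → (encircledLink o).Component →₀ ℤ)
    (PR : R → (encircledLink o).Component →₀ ℤ) (s : P.Segment)
    (hs : s ∉ Set.range (Sum.elim (overSegment o) (underSegment o))) :
    numbering o PV PR (nextSegment o s) = numbering o PV PR s := by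
  have hover : ∀ c, overSegment o c ≠ s := fun c h => hs ⟨Sum.inl c, h⟩
  have hunder : ∀ c, underSegment o c ≠ s := fun c h => hs ⟨Sum.inr c, h⟩
  rcases s with ⟨d, j⟩ | ⟨j, hj⟩ | ⟨j, hj⟩
  · have hfb : d ∈ Set.range P.cut → j ≠ if o.dir d then 0 else 1 := by
      rintro ⟨i, rfl⟩ h; exact hover (.firstBack i) (by simp [overSegment, h])
    have hff : d ∈ Set.range P.cut → j ≠ if o.dir d then 1 else 2 := by
      rintro ⟨i, rfl⟩ h; exact hunder (.firstFront i) (by simp [underSegment, h])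
    have hsb : P.rot d ∈ Set.range P.cut → j ≠ if o.dir d then 3 else 4 := by
      rintro ⟨i, hi⟩ h; exact hover (.secondBack i) (by simp [overSegment, hi, h])
    have hsf : P.rot d ∈ Set.range P.cut → j ≠ if o.dir d then 2 else 3 := by
      rintro ⟨i, hi⟩ h; exact hunder (.secondFront i) (by simp [underSegment, hi, h])
    cases h : o.dir d
    · obtain ⟨h4, h3, h2, h1, h0⟩ := next_strand_of_not_dir h
      rw [h] at hfb hff hsb hsf
      have hj0 : j ≠ 0 := by
        rintro rfl
        exact hs (firstIn_of_not_dir h ▸ (edge_mem_range o d.1).1)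
      fin_cases j <;> simp_all [numbering]
    · obtain ⟨h1, h2, h3, h4, h0⟩ := next_strand_of_dir h
      rw [h] at hfb hff hsb hsf
      have hj0 : j ≠ 4 := by
        rintro rfl
        exact hs (secondIn_of_dir h ▸ (edge_mem_range o (P.rot d).1).2)
      fin_cases j <;> simp_all [numbering]
  · have hjk : j = 2 * P.k := by
      by_contra hne
      rcases Nat.even_or_odd' j with ⟨i, rfl | rfl⟩
      · exact hover (.firstFront ⟨i, by omega⟩) rfl
      · exact hover (.secondFront ⟨i, by omega⟩) rfl
    simp [nextSegment, numbering, hjk]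
  · have hjk : j = 0 := by
      by_contra hne
      rcases Nat.even_or_odd' j with ⟨i, rfl | rfl⟩
      · obtain ⟨i, rfl⟩ := Nat.exists_eq_succ_of_ne_zero (show i ≠ 0 by omega)
        exact hunder (.secondBack ⟨i, by omega⟩) rfl
      · exact hunder (.firstBack ⟨i, by omega⟩) rfl
    simp [nextSegment, numbering, hjk]

/-- The regions on the two sides of the cuts would give j = i + 1 and i = j + 1, since γ never
returns to a region. -/
theorem rev_cut_ne (i j : Fin P.k) : Dart.rev (P.cut i) ≠ P.cut j := by
  intro h
  have h1 := P.right_cut i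
  have h2 := P.right_cut j
  rw [h, P.left_cut] at h1
  rw [← h, Dart.rev_rev, P.left_cut] at h2
  have h1 := congrArg Fin.val (P.path_injective h1)
  have h2 := congrArg Fin.val (P.path_injective h2)
  simp at h1 h2
  omega

set_option linter.unusedSimpArgs false in
-- Vertices and regions are the faces of the medial diagram, and each corner strand separates a
-- vertex face from a region face. The prescribed jumps across the strands are balanced at each
-- medial crossing, so `exists_potential` integrates them. Inside C the number is raised by the
-- variable of C.
theorem exists_numbering : ∃ lab, (encircledLink o).IsNumbering lab := by
  classical
  obtain ⟨w, u, hwu⟩ := P.exists_potential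
    (fun d => (if o.dir d then 1 else -1 : ℤ) •
      (Finsupp.single (strandComponent o d) 1 : (encircledLink o).Component →₀ ℤ)) (fun e => by
    have h1 := o.dir_first (e, true)
    have h2 := o.dir_second (e, true)
    have h3 := strandComponent_rev o (e, true)
    have h4 := strandComponent_rot_symm_rev o (e, true)
    simp only [Dart.rev, Bool.not_true] at h1 h2 h3 h4
    rw [h1, h2, h3, h4]
    cases o.dir (e, true) <;> cases o.dir (P.rot.symm (e, true)) <;> simp)
  -- A potential enters as a sum of vertex and region parts; the change of sign turns it into a
  -- jump.
  obtain ⟨PR, hPR⟩ : ∃ PR : R → (encircledLink o).Component →₀ ℤ, ∀ r, u r = -PR r :=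
    ⟨fun r => -u r, by simp⟩
  have hpos : ∀ d, o.dir d = true →
      w (G.start d) = PR (P.left d) + Finsupp.single (strandComponent o d) 1 := fun d h => by
    have := hwu d
    rw [h, hPR, if_pos rfl, one_smul] at this
    rw [this]; abel
  have hneg : ∀ d, o.dir d = false →
      PR (P.left d) = w (G.start d) + Finsupp.single (strandComponent o d) 1 := fun d h => by
    have := hwu d
    rw [h, hPR, if_neg (by simp), neg_smul, one_smul, neg_eq_iff_eq_neg] at this
    rw [this]; abel
  have hsign : ∀ e, G.sign e = 1 ∨ G.sign e = -1 := fun e => Int.units_eq_one_or _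
  have hone : (-1 : ℤˣ) ≠ 1 := by decide
  have hedge : ∀ e, ∃ t₁ t₂ : (encircledLink o).Component,
      (encircledLink o).component (firstIn o e) = t₁ ∧
      (encircledLink o).component (secondIn o e) = t₂ ∧
      ((crossingSign o (.edge e) = G.sign e ∧
        numbering o w PR (firstIn o e) =
          numbering o w PR (secondIn o e) + Finsupp.single t₂ 1 ∧
        numbering o w PR (nextSegment o (firstIn o e)) = numbering o w PR (secondIn o e) ∧
        numbering o w PR (nextSegment o (secondIn o e)) =
          numbering o w PR (secondIn o e) + Finsupp.single t₁ 1) ∨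
       (crossingSign o (.edge e) = -G.sign e ∧
        numbering o w PR (nextSegment o (secondIn o e)) = numbering o w PR (firstIn o e) ∧
        numbering o w PR (nextSegment o (firstIn o e)) =
          numbering o w PR (firstIn o e) + Finsupp.single t₂ 1 ∧
        numbering o w PR (secondIn o e) =
          numbering o w PR (firstIn o e) + Finsupp.single t₁ 1)) := by
    intro e
    obtain ⟨d₁, d₂, rfl, hd₁, hd₂, h1, h2, h3⟩ := exists_strands o e
    refine ⟨strandComponent o d₁, strandComponent o d₂, by rw [h1, component_strand],
      by rw [h2, component_strand], ?_⟩
    have hr : o.dir (Dart.rev d₁) = true := by rw [o.dir_first, hd₁]; rfl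
    have hs : o.dir (P.rot.symm (Dart.rev (P.rot d₂))) = false := by
      rw [dir_rot_symm_rev_rot, hd₂]; rfl
    have e1 : numbering o w PR (.strand d₁ 0) = w (G.start d₁) := by simp [numbering, hd₁]
    have e2 : numbering o w PR (.strand (Dart.rev d₁) 0) = PR (P.left (Dart.rev d₁)) := by
      simp [numbering, hr]
    have e3 : numbering o w PR (.strand d₂ 4) = PR (P.left d₂) := by simp [numbering, hd₂]
    have e4 : numbering o w PR (.strand (P.rot.symm (Dart.rev (P.rot d₂))) 4) =
        w (G.start (Dart.rev (P.rot d₂))) := by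
      simp [numbering, hs, P.start_rot_symm]
    rw [h1, h2, (next_strand_of_not_dir hd₁).2.2.2.2, (next_strand_of_dir hd₂).2.2.2.2,
      e1, e2, e3, e4, P.left_corner d₂]
    rcases h3 with ⟨h3, h4⟩ | ⟨h3, h4⟩
    · left
      have p1 := hpos d₂ hd₂
      have p2 := hpos _ hr
      rw [P.left_corner, ← P.start_rot, h3] at p1
      rw [strandComponent_rev] at p2
      rw [h3]
      exact ⟨h4, p1, rfl, p2⟩
    · right
      have p1 := hneg d₁ hd₁
      have p2 := hneg _ hs
      rw [strandComponent_rot_symm_rev, Equiv.symm_apply_apply, P.left_rot_symm,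
        P.start_rot_symm, Dart.rev_rev] at p2
      rw [h3] at p2 ⊢
      rw [Dart.rev_rev] at p2 ⊢
      exact ⟨h4, rfl, p2, p1⟩
  have hfirst : ∀ i : Fin P.k,
      numbering o w PR (.front ⟨2 * i, by omega⟩) = PR (P.left (P.cut i)) ∧
      numbering o w PR (.front ⟨2 * i + 1, by omega⟩) = w (G.start (P.cut i)) ∧
      numbering o w PR (.back ⟨2 * i + 1, by omega⟩) = w (G.start (P.cut i)) ∧
      numbering o w PR (.back ⟨2 * i, by omega⟩) = PR (P.left (P.cut i)) := fun i => by
    simp only [numbering, alongPath_odd, P.left_cut]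
    exact ⟨alongPath_even _ _ (by omega), trivial, trivial, alongPath_even _ _ (by omega)⟩
  have hsecond : ∀ i : Fin P.k,
      numbering o w PR (.front ⟨2 * i + 2, by omega⟩) = PR (P.left (P.rot.symm (P.cut i))) ∧
      numbering o w PR (.back ⟨2 * i + 2, by omega⟩) = PR (P.left (P.rot.symm (P.cut i))) := fun i => by
    simp only [numbering, P.left_rot_symm, P.right_cut]
    exact ⟨alongPath_even (i := i + 1) _ _ (by omega), alongPath_even (i := i + 1) _ _ (by omega)⟩
  have hnf : ∀ i : Fin P.k,
      nextSegment o (.front ⟨2 * i, by omega⟩) = .front ⟨2 * i + 1, by omega⟩ ∧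
      nextSegment o (.front ⟨2 * i + 1, by omega⟩) = .front ⟨2 * i + 2, by omega⟩ ∧
      nextSegment o (.back ⟨2 * i + 1, by omega⟩) = .back ⟨2 * i, by omega⟩ ∧
      nextSegment o (.back ⟨2 * i + 2, by omega⟩) = .back ⟨2 * i + 1, by omega⟩ := fun i => by
    have := i.2
    simp [nextSegment, show 2 * (i : ℕ) + 1 < 2 * P.k by omega]
  have hstrand : ∀ d j, numbering o w PR (.strand d j) =
      (if o.dir d then PR (P.left d) else w (G.start d)) + if (j = 1 ∧ d ∈ Set.range P.cut) ∨
        (j = 3 ∧ P.rot d ∈ Set.range P.cut) then Finsupp.single (circle o) 1 else 0 := fun d j => by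
    simp only [numbering]
  have hcut1 : ∀ i, P.cut i ∈ Set.range P.cut := fun i => ⟨i, rfl⟩
  have hcut2 : ∀ i, P.rot (P.rot.symm (P.cut i)) ∈ Set.range P.cut := fun i => ⟨i, by simp⟩
  refine ⟨numbering o w PR, numbering_join o w PR, ?_, ?_⟩
  · rintro (e | i | i | i | i) hc <;> simp only [encircledLink_next, encircledLink_overIn,
      encircledLink_underIn, encircledLink_sign] at hc ⊢
    · obtain ⟨t₁, t₂, rfl, rfl, ⟨h0, h1, h2, h3⟩ | ⟨h0, h1, h2, h3⟩⟩ := hedge e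
      · have hσ : G.sign e = 1 := h0.symm.trans hc
        simp only [overSegment, underSegment, hσ, if_true]
        exact ⟨h1, h2, h3⟩
      · have hσ : G.sign e ≠ 1 := fun h => hone (by rw [← h, ← h0, hc, h])
        simp only [overSegment, underSegment, hσ, if_false]
        exact ⟨h3, h1, h2⟩
    · cases h : o.dir (P.cut i)
      swap
      · simp [crossingSign, h] at hc
      obtain ⟨n3, n2, n1, n0, -⟩ := next_strand_of_not_dir h
      have p := hneg _ h
      simp [overSegment, underSegment, h, n0, n1, n2, n3, hnf, hfirst, hsecond, hstrand, hcut1, hcut2,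
        component_strand, component_front, component_back, p, P.start_rot_symm]
    · cases h : o.dir (P.cut i)
      swap
      · simp [crossingSign, h] at hc
      obtain ⟨n3, n2, n1, n0, -⟩ := next_strand_of_not_dir h
      have p := hneg _ h
      simp [overSegment, underSegment, h, n0, n1, n2, n3, hnf, hfirst, hsecond, hstrand, hcut1, hcut2,
        component_strand, component_front, component_back, p, P.start_rot_symm]
    · cases h : o.dir (P.rot.symm (P.cut i))
      · simp [crossingSign, h] at hc
      obtain ⟨n0, n1, n2, n3, -⟩ := next_strand_of_dir h
      have p := hpos _ h
      rw [P.start_rot_symm] at p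
      simp [overSegment, underSegment, h, n0, n1, n2, n3, hnf, hfirst, hsecond, hstrand, hcut1, hcut2,
        component_strand, component_front, component_back, p, P.start_rot_symm]
    · cases h : o.dir (P.rot.symm (P.cut i))
      · simp [crossingSign, h] at hc
      obtain ⟨n0, n1, n2, n3, -⟩ := next_strand_of_dir h
      have p := hpos _ h
      rw [P.start_rot_symm] at p
      simp [overSegment, underSegment, h, n0, n1, n2, n3, hnf, hfirst, hsecond, hstrand, hcut1, hcut2,
        component_strand, component_front, component_back, p, P.start_rot_symm]
  · rintro (e | i | i | i | i) hc <;> simp only [encircledLink_next, encircledLink_overIn,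
      encircledLink_underIn, encircledLink_sign] at hc ⊢
    · obtain ⟨t₁, t₂, rfl, rfl, ⟨h0, h1, h2, h3⟩ | ⟨h0, h1, h2, h3⟩⟩ := hedge e
      · have hσ : G.sign e ≠ 1 := fun h => hc (h0.trans h)
        simp only [overSegment, underSegment, hσ, if_false]
        rw [h2]
        exact ⟨h1, rfl, h3⟩
      · have hσ : G.sign e = 1 := by
          rcases hsign e with h | h
          · exact h
          · exact absurd (by rw [h0, h, neg_neg]) hc
        simp only [overSegment, underSegment, hσ, if_true]
        rw [h1]
        exact ⟨h3, rfl, h2⟩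
    · cases h : o.dir (P.cut i)
      · simp [crossingSign, h] at hc
      obtain ⟨n0, n1, n2, n3, -⟩ := next_strand_of_dir h
      have p := hpos _ h
      simp [overSegment, underSegment, h, n0, n1, n2, n3, hnf, hfirst, hsecond, hstrand, hcut1, hcut2,
        component_strand, component_front, component_back, p, P.start_rot_symm]
    · cases h : o.dir (P.cut i)
      · simp [crossingSign, h] at hc
      obtain ⟨n0, n1, n2, n3, -⟩ := next_strand_of_dir h
      have p := hpos _ h
      simp [overSegment, underSegment, h, n0, n1, n2, n3, hnf, hfirst, hsecond, hstrand, hcut1, hcut2,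
        component_strand, component_front, component_back, p, P.start_rot_symm]
    · cases h : o.dir (P.rot.symm (P.cut i))
      swap
      · simp [crossingSign, h] at hc
      obtain ⟨n3, n2, n1, n0, -⟩ := next_strand_of_not_dir h
      have p := hneg _ h
      rw [P.start_rot_symm] at p
      simp [overSegment, underSegment, h, n0, n1, n2, n3, hnf, hfirst, hsecond, hstrand, hcut1, hcut2,
        component_strand, component_front, component_back, p, P.start_rot_symm]
    · cases h : o.dir (P.rot.symm (P.cut i))
      swap
      · simp [crossingSign, h] at hc
      obtain ⟨n3, n2, n1, n0, -⟩ := next_strand_of_not_dir h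
      have p := hneg _ h
      rw [P.start_rot_symm] at p
      simp [overSegment, underSegment, h, n0, n1, n2, n3, hnf, hfirst, hsecond, hstrand, hcut1, hcut2,
        component_strand, component_front, component_back, p, P.start_rot_symm]

end AnnularEmbedding

/-- T is the arc φ a, φ² a, …, b of the cycle, stopped at the first visit to b. -/
theorem Equiv.Perm.SameCycle.exists_arc {α : Type*} [Finite α] {φ : Equiv.Perm α} {a b : α}
    (h : φ.SameCycle a b) (hab : a ≠ b) :
    ∃ T : Set α, b ∈ T ∧ φ b ∉ T ∧ a ∉ T ∧ φ a ∈ T ∧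
      ∀ d, d ≠ a → d ≠ b → (φ d ∈ T ↔ d ∈ T) := by
  classical
  have hex : ∃ n : ℕ, (φ ^ n) a = b := h.exists_nat_pow_eq
  set m := Nat.find hex with hm
  have hmb : (φ ^ m) a = b := Nat.find_spec hex
  have hmin : ∀ l < m, (φ ^ l) a ≠ b := fun l hl => Nat.find_min hex hl
  have hm0 : m ≠ 0 := fun h0 => hab (by rw [← hmb, h0]; rfl)
  have hsucc : ∀ l, (φ ^ (l + 1)) a = φ ((φ ^ l) a) := fun l => by
    rw [pow_succ', Equiv.Perm.mul_apply]
  refine ⟨{d | ∃ l, l < m ∧ (φ ^ (l + 1)) a = d}, ⟨m - 1, by omega, ?_⟩, ?_, ?_,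
    ⟨0, by omega, by simp⟩, fun d hda hdb => ⟨?_, ?_⟩⟩
  · rw [show m - 1 + 1 = m by omega, hmb]
  · rintro ⟨l, hl, hl'⟩
    rw [hsucc] at hl'
    exact hmin l hl (φ.injective hl')
  · rintro ⟨l, hl, hl'⟩
    apply hmin (m - (l + 1)) (by omega)
    nth_rw 1 [← hl']
    rw [← Equiv.Perm.mul_apply, ← pow_add, show m - (l + 1) + (l + 1) = m by omega, hmb]
  · rintro ⟨l, hl, hl'⟩
    rw [hsucc] at hl'
    have := φ.injective hl'
    rcases l with _ | l
    · exact absurd this.symm hda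
    · exact ⟨l, by omega, this⟩
  · rintro ⟨l, hl, rfl⟩
    refine ⟨l + 1, ?_, by rw [hsucc]⟩
    rcases Nat.lt_or_ge (l + 1) m with h1 | h1
    · exact h1
    · exact absurd (by rw [show l + 1 = m by omega, hmb]) hdb

/-! ### Flows across γ and twisted potentials. -/

namespace AnnularEmbedding

variable {V E R : Type*} [Fintype V] [Fintype E] [Fintype R] {G : PeriodicGraph V E}
  (P : AnnularEmbedding G R)

/-- The directed edge `d` is followed by `face d` on the boundary of the region to its left. -/
def face : Equiv.Perm (E × Bool) := (revEquiv E).trans P.rot.symm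

theorem face_apply (d : E × Bool) : P.face d = P.rot.symm (Dart.rev d) := rfl

theorem left_face (d : E × Bool) : P.left (P.face d) = P.left d := by
  rw [face_apply, left_rot_symm, Dart.rev_rev]

variable {A W : Type*} [CommRing A] [AddCommGroup W] [Module A W] (x : Aˣ)

open Classical in
/-- The holonomy of the crossings of `γ` with the first half of a directed edge. -/
def twist (d : E × Bool) : Aˣ := if d ∈ Set.range P.cut then x else 1

theorem twist_cut (i : Fin P.k) : P.twist x (P.cut i) = x := if_pos ⟨i, rfl⟩

theorem twist_rev_cut (i : Fin P.k) : P.twist x (Dart.rev (P.cut i)) = 1 :=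
  if_neg fun ⟨j, hj⟩ => rev_cut_ne i j hj.symm

/-- The flow across the first crossings of `γ` with the graph. -/
def flux (f : E × Bool → W) (n : ℕ) : W := ∑ j : Fin P.k, if (j : ℕ) < n then f (P.cut j) else 0

theorem flux_zero (f : E × Bool → W) : P.flux f 0 = 0 := by simp [flux]

theorem flux_succ (f : E × Bool → W) (i : Fin P.k) :
    P.flux f (i + 1) = P.flux f i + f (P.cut i) := by
  classical
  have : ∀ j : Fin P.k, (if (j : ℕ) < i + 1 then f (P.cut j) else 0) =
      (if (j : ℕ) < i then f (P.cut j) else 0) + if j = i then f (P.cut j) else 0 := fun j => by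
    rcases lt_trichotomy j i with h | h | h
    · have : (j : ℕ) < i := h
      simp [this, h.ne, Nat.lt_succ_of_lt this]
    · simp [h]
    · have : (i : ℕ) < j := h
      simp [h.ne', show ¬ (j : ℕ) < i + 1 by omega, show ¬ (j : ℕ) < i by omega]
  simp only [flux, this, Finset.sum_add_distrib, Finset.sum_ite_eq', Finset.mem_univ, if_true]

variable {x} {m f : E × Bool → W}

open Classical in
-- Sum `hm` over all corners at vertices with w = β. The left side telescopes, and the untwisted
-- flow cancels in pairs, because w is constant along edges; the twist leaves x - 1 times the flow
-- through the cuts in question.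
theorem sum_flux_eq_zero (hf : ∀ d, f (Dart.rev d) = -f d)
    (hm : ∀ d, m d - m (P.rot.symm d) = P.twist x d • f d) {Z : Type*} {w : V → Z}
    (hw : ∀ d, w (G.start d) = w (G.start (Dart.rev d))) (β : Z) :
    ((x : A) - 1) • ∑ j : Fin P.k, (if w (G.start (P.cut j)) = β then f (P.cut j) else 0) = 0 := by
  have h1 : ∑ d, (if w (G.start d) = β then m d - m (P.rot.symm d) else 0) = 0 := by
    have : ∀ d, (if w (G.start d) = β then m d - m (P.rot.symm d) else 0) =
        (if w (G.start d) = β then m d else 0) -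
          if w (G.start d) = β then m (P.rot.symm d) else 0 := fun d => by
      split_ifs <;> simp
    simp only [this, Finset.sum_sub_distrib]
    rw [sub_eq_zero, ← Equiv.sum_comp P.rot.symm]
    simp only [P.start_rot_symm]
  have h2 : ∑ d, (if w (G.start d) = β then f d else 0) = 0 := by
    rw [Fintype.sum_prod_type]
    apply Finset.sum_eq_zero
    intro e _
    have e1 := hf (e, true)
    have e2 := hw (e, true)
    simp only [Dart.rev, Bool.not_true] at e1 e2
    rw [Fintype.sum_bool, e1, e2]
    split_ifs <;> simp
  have h3 : ∀ d, (if w (G.start d) = β then m d - m (P.rot.symm d) else 0) =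
      (if w (G.start d) = β then f d else 0) + ∑ j : Fin P.k, if P.cut j = d then
        ((x : A) - 1) • (if w (G.start d) = β then f d else 0) else 0 := fun d => by
    rw [hm]
    by_cases hd : d ∈ Set.range P.cut
    · obtain ⟨i, rfl⟩ := hd
      rw [twist_cut]
      simp only [P.cut_injective.eq_iff, Finset.sum_ite_eq', Finset.mem_univ, if_true]
      split_ifs
      · rw [sub_smul, one_smul, Units.smul_def]; abel
      · simp
    · have : ∀ j, P.cut j ≠ d := fun j hj => hd ⟨j, hj⟩
      simp [this, twist, hd]
  simp only [h3, Finset.sum_add_distrib, h2, zero_add] at h1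
  rw [Finset.sum_comm] at h1
  simpa only [Finset.sum_ite_eq, Finset.mem_univ, if_true, ← Finset.smul_sum] using h1

theorem smul_flux_total (hf : ∀ d, f (Dart.rev d) = -f d)
    (hm : ∀ d, m d - m (P.rot.symm d) = P.twist x d • f d) :
    ((x : A) - 1) • P.flux f P.k = 0 := by
  classical
  rw [← P.sum_flux_eq_zero hf hm (w := fun _ => ()) (fun _ => rfl) (), flux]
  simp

/-- If γ enters and leaves a region through different boundary walks, the components of the graph
that it met before and those that it meets afterwards are separated by a function w that is constant
along edges, and `sum_flux_eq_zero` applies to the earlier ones. -/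
theorem smul_flux_of_not_sameCycle (hf : ∀ d, f (Dart.rev d) = -f d)
    (hm : ∀ d, m d - m (P.rot.symm d) = P.twist x d • f d) (j : ℕ) (hj : j + 1 < P.k)
    (h : ¬ P.face.SameCycle (Dart.rev (P.cut ⟨j, by omega⟩)) (P.cut ⟨j + 1, hj⟩)) :
    ((x : A) - 1) • P.flux f (j + 1) = 0 := by
  classical
  -- The indicator of the boundary walk through which γ leaves. It is invariant under `face`, so the
  -- vertex part of its potential is constant along edges; along γ that part jumps only in the
  -- region of this walk.
  let c : E × Bool → ℤ := fun d => if P.face.SameCycle d (P.cut ⟨j + 1, hj⟩) then 1 else 0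
  have hc : ∀ d, c (P.face d) = c d := fun d => by
    simp only [c, Equiv.Perm.sameCycle_apply_left]
  obtain ⟨w, u, hwu⟩ := P.exists_potential c fun e => by
    have h1 := hc (e, true)
    have h2 := hc (e, false)
    simp only [face_apply, Dart.rev, Bool.not_true, Bool.not_false] at h1 h2
    rw [h1, h2, add_comm]
  have hw : ∀ d, w (G.start d) = w (G.start (Dart.rev d)) := fun d => by
    have h1 := hc d
    rw [hwu, hwu, left_face, face_apply, P.start_rot_symm] at h1
    linarith
  have hstep : ∀ (l : ℕ) (hl : l + 1 < P.k), w (G.start (P.cut ⟨l + 1, hl⟩)) =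
      w (G.start (P.cut ⟨l, by omega⟩)) + if l = j then 1 else 0 := fun l hl => by
    have h1 := hwu (P.cut ⟨l + 1, hl⟩)
    have h2 := hwu (Dart.rev (P.cut ⟨l, by omega⟩))
    rw [P.left_cut] at h1
    rw [P.right_cut, ← hw] at h2
    have h3 : c (P.cut ⟨l + 1, hl⟩) - c (Dart.rev (P.cut ⟨l, by omega⟩)) =
        if l = j then 1 else 0 := by
      have hleft : ∀ d, P.face.SameCycle d (P.cut ⟨j + 1, hj⟩) →
          P.left d = P.path ⟨j + 1, by omega⟩ := fun d hd => by
        obtain ⟨n, hn⟩ := hd.exists_nat_pow_eq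
        have : ∀ n : ℕ, P.left ((P.face ^ n) d) = P.left d := fun n => by
          induction n with
          | zero => rfl
          | succ n ih => rw [pow_succ', Equiv.Perm.mul_apply, left_face, ih]
        rw [← this n, hn, P.left_cut]
        rfl
      split_ifs with hlj
      · subst hlj
        simp [c, h, Equiv.Perm.SameCycle.refl]
      · have e1 : c (P.cut ⟨l + 1, hl⟩) = 0 := if_neg fun hs => by
          have := congrArg Fin.val (P.path_injective ((P.left_cut _).symm.trans (hleft _ hs)))
          simp at this
          exact hlj this
        have e2 : c (Dart.rev (P.cut ⟨l, by omega⟩)) = 0 := if_neg fun hs => by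
          have := congrArg Fin.val (P.path_injective ((P.right_cut _).symm.trans (hleft _ hs)))
          simp at this
          exact hlj this
        rw [e1, e2, sub_zero]
    have h4 : P.path (Fin.castSucc ⟨l + 1, hl⟩) = P.path (Fin.succ ⟨l, by omega⟩) := rfl
    rw [h4] at h1
    linarith
  have hall : ∀ (l : ℕ) (hl : l < P.k), w (G.start (P.cut ⟨l, hl⟩)) =
      w (G.start (P.cut ⟨0, by omega⟩)) + if l < j + 1 then 0 else 1 := by
    intro l
    induction l with
    | zero => intro _; simp
    | succ l ih =>
      intro hl
      rw [hstep l hl, ih (by omega), add_assoc]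
      congr 1
      rcases lt_trichotomy l j with h | h | h
      · simp [h.ne, h, show l < j + 1 by omega]
      · simp [h]
      · simp [h.ne', show ¬ l < j + 1 by omega, show ¬ l < j by omega]
  have := P.sum_flux_eq_zero hf hm hw (w (G.start (P.cut ⟨0, by omega⟩)))
  rw [← this, flux]
  congr 1
  apply Finset.sum_congr rfl
  rintro ⟨l, hl⟩ _
  rw [hall l hl]
  by_cases h : l < j + 1 <;> simp [h]

/-- If γ enters and leaves region i through one boundary walk, it splits the walk into two arcs; η
is -(x - 1) times the flux on one arc and zero elsewhere. In all other cases this constant vanishes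
and η = 0 will do. -/
theorem exists_correction_at (hf : ∀ d, f (Dart.rev d) = -f d)
    (hm : ∀ d, m d - m (P.rot.symm d) = P.twist x d • f d) (i : Fin (P.k + 1)) :
    ∃ η : E × Bool → W,
      (∀ d, d ∉ Set.range P.cut → Dart.rev d ∉ Set.range P.cut → η (P.face d) = η d) ∧
      (∀ j : Fin P.k, j.castSucc = i → η (P.cut j) = -(((x : A) - 1) • P.flux f i) ∧
        η (P.face (P.cut j)) = 0) ∧
      (∀ j : Fin P.k, j.succ = i → η (Dart.rev (P.cut j)) = 0 ∧
        η (P.face (Dart.rev (P.cut j))) = -(((x : A) - 1) • P.flux f i)) ∧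
      ∀ d, η d = 0 ∨ η d = -(((x : A) - 1) • P.flux f i) := by
  classical
  by_cases h0 : ((x : A) - 1) • P.flux f i = 0
  · exact ⟨0, by simp [h0]⟩
  obtain ⟨i, hi⟩ := i
  obtain ⟨j, rfl⟩ : ∃ j, i = j + 1 := Nat.exists_eq_succ_of_ne_zero (by
    rintro rfl
    exact h0 (by rw [flux_zero, smul_zero]))
  have hjk : j + 1 < P.k := by
    by_contra hne
    have hk : j + 1 = P.k := by omega
    exact h0 ((congrArg (fun n => ((x : A) - 1) • P.flux f n) hk).trans (P.smul_flux_total hf hm))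
  have hs : P.face.SameCycle (Dart.rev (P.cut ⟨j, by omega⟩)) (P.cut ⟨j + 1, hjk⟩) := by
    by_contra hne
    exact h0 (P.smul_flux_of_not_sameCycle hf hm j hjk hne)
  obtain ⟨T, h1, h2, h3, h4, h5⟩ := hs.exists_arc (rev_cut_ne _ _)
  refine ⟨fun d => if d ∈ T then -(((x : A) - 1) • P.flux f (j + 1)) else 0,
    fun d hd hd' => ?_, fun l hl => ?_, fun l hl => ?_, fun d => ?_⟩
  · have := h5 d (fun h => hd' ⟨_, by rw [h, Dart.rev_rev]⟩) (fun h => hd ⟨_, h.symm⟩)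
    simp only [this]
  · obtain ⟨l, hl'⟩ := l
    obtain rfl : l = j + 1 := congrArg Fin.val hl
    exact ⟨if_pos h1, if_neg h2⟩
  · obtain ⟨l, hl'⟩ := l
    obtain rfl : l = j := by simpa using congrArg Fin.val hl
    exact ⟨if_neg h3, if_pos h4⟩
  · dsimp only
    split_ifs
    · exact Or.inr rfl
    · exact Or.inl rfl

/-- The corrections for different i concern different regions, as `path` is injective, so they can
be glued. -/
theorem exists_correction (hf : ∀ d, f (Dart.rev d) = -f d)
    (hm : ∀ d, m d - m (P.rot.symm d) = P.twist x d • f d) :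
    ∃ η : E × Bool → W,
      (∀ d, d ∉ Set.range P.cut → Dart.rev d ∉ Set.range P.cut → η (P.face d) = η d) ∧
      (∀ j : Fin P.k, η (P.cut j) = -(((x : A) - 1) • P.flux f j) ∧
        η (P.face (P.cut j)) = 0) ∧
      (∀ j : Fin P.k, η (Dart.rev (P.cut j)) = 0 ∧
        η (P.face (Dart.rev (P.cut j))) = -(((x : A) - 1) • P.flux f (j + 1))) ∧
      ∀ d, ∃ n, η d = 0 ∨ η d = -(((x : A) - 1) • P.flux f n) := by
  classical
  choose η h1 h2 h3 h4 using P.exists_correction_at hf hm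
  let η' : E × Bool → W := fun d => if h : ∃ i, P.path i = P.left d then η h.choose d else 0
  have hη : ∀ d i, P.left d = P.path i → η' d = η i d := fun d i hd => by
    have hex : ∃ i, P.path i = P.left d := ⟨i, hd.symm⟩
    have : hex.choose = i := P.path_injective (hex.choose_spec.trans hd)
    simp only [η', dif_pos hex, this]
  refine ⟨η', fun d hd hd' => ?_, fun j => ?_, fun j => ?_, fun d => ?_⟩
  · by_cases hex : ∃ i, P.path i = P.left d
    · obtain ⟨i, hi⟩ := hex
      rw [hη d i hi.symm, hη _ i ((P.left_face d).trans hi.symm), h1 i d hd hd']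
    · simp only [η', left_face, dif_neg hex]
  · rw [hη _ _ (P.left_cut j), hη _ _ ((P.left_face _).trans (P.left_cut j))]
    exact h2 _ j rfl
  · rw [hη _ _ (P.right_cut j), hη _ _ ((P.left_face _).trans (P.right_cut j))]
    exact h3 _ j rfl
  · by_cases hex : ∃ i, P.path i = P.left d
    · obtain ⟨i, hi⟩ := hex
      rw [hη d i hi.symm]
      exact ⟨i, h4 i d⟩
    · exact ⟨0, Or.inl (dif_neg hex)⟩

/-- Vanishing of the first cohomology with twisted coefficients. -/
theorem exists_twisted_potential (hf : ∀ d, f (Dart.rev d) = -f d)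
    (hm : ∀ d, m d - m (P.rot.symm d) = P.twist x d • f d) :
    ∃ (w : V → W) (ρ : E × Bool → W) (u : R → W), u (P.path 0) = 0 ∧
      (∀ d, m d = w (G.start d) + ρ d) ∧
      (∀ d, (P.twist x d)⁻¹ • ρ d = (P.twist x (Dart.rev d))⁻¹ • ρ (P.face d)) ∧
      ∀ S : Submodule A W, (∀ d, f d ∈ S) → ∀ d, ρ d - u (P.left d) ∈ S := by
  classical
  obtain ⟨η, h1, h2, h3, h4⟩ := P.exists_correction hf hm
  -- This makes m - η balanced around every edge: where γ crosses, m is unbalanced by (x - 1) • f,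
  -- which is (x - 1) times the difference of consecutive fluxes.
  have hδ : ∀ d, (m d - m (P.rot.symm d)) + (m (Dart.rev d) - m (P.rot.symm (Dart.rev d))) =
      (η d - η (P.face d)) + (η (Dart.rev d) - η (P.face (Dart.rev d))) := by
    have key : ∀ j, (m (P.cut j) - m (P.rot.symm (P.cut j))) +
        (m (Dart.rev (P.cut j)) - m (P.rot.symm (Dart.rev (P.cut j)))) =
        (η (P.cut j) - η (P.face (P.cut j))) +
        (η (Dart.rev (P.cut j)) - η (P.face (Dart.rev (P.cut j)))) := fun j => by
      rw [hm, hm, twist_cut, twist_rev_cut, (h2 j).1, (h2 j).2, (h3 j).1, (h3 j).2, flux_succ, hf,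
        one_smul, Units.smul_def]
      module
    intro d
    by_cases hd : d ∈ Set.range P.cut
    · obtain ⟨j, rfl⟩ := hd
      exact key j
    by_cases hd' : Dart.rev d ∈ Set.range P.cut
    · obtain ⟨j, hj⟩ := hd'
      obtain rfl : d = Dart.rev (P.cut j) := by rw [hj, Dart.rev_rev]
      have := key j
      rw [Dart.rev_rev]
      rw [add_comm, this, add_comm]
    · rw [h1 d hd hd', h1 (Dart.rev d) hd' (by rwa [Dart.rev_rev]), hm, hm, hf]
      simp [twist, hd, hd']
  obtain ⟨w, u, hwu⟩ := P.exists_potential (fun d => m d - η d) fun e => by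
    have := hδ (e, true)
    simp only [face_apply, Dart.rev, Bool.not_true, Bool.not_false] at this
    rw [← sub_eq_zero] at this ⊢
    rw [← this]
    abel
  have hu : ∀ i : Fin P.k, f (P.cut i) = u (P.path i.castSucc) - u (P.path i.succ) := fun i => by
    have e1 := hwu (P.cut i)
    have e2 := hwu (P.face (Dart.rev (P.cut i)))
    have e3 := hm (P.cut i)
    rw [left_face, P.right_cut, face_apply, Dart.rev_rev, P.start_rot_symm] at e2
    have e4 := (h3 i).2
    rw [face_apply, Dart.rev_rev] at e4
    rw [twist_cut, Units.smul_def] at e3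
    rw [e4, flux_succ] at e2
    rw [(h2 i).1, P.left_cut] at e1
    have e5 := congrArg₂ (· - ·) e1 e2
    simp only [add_sub_add_left_eq_sub] at e5
    rw [← e5, sub_sub_sub_comm, e3]
    module
  have hflux : ∀ i : Fin (P.k + 1), u (P.path i) = u (P.path 0) - P.flux f i := by
    intro i
    induction i using Fin.induction with
    | zero => simp [flux_zero]
    | succ i ih =>
      rw [Fin.val_succ, flux_succ, ← sub_sub, ← Fin.val_castSucc i, ← ih, hu]
      abel
  -- With u normalized to zero at `path 0`, its value at `path i` is minus the flux. So in this
  -- region ρ is -flux on one side of γ and -x • flux on the other, as the twist demands.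
  refine ⟨fun v => w v + u (P.path 0), fun d => u (P.left d) - u (P.path 0) + η d,
    fun r => u r - u (P.path 0), sub_self _, fun d => ?_, ?_, fun S hS d => ?_⟩
  · have := hwu d
    rw [sub_eq_iff_eq_add] at this
    rw [this]
    dsimp only
    abel
  · have key1 : ∀ i, (P.twist x (P.cut i))⁻¹ • (u (P.left (P.cut i)) - u (P.path 0) + η (P.cut i)) =
        (P.twist x (Dart.rev (P.cut i)))⁻¹ •
          (u (P.left (P.face (P.cut i))) - u (P.path 0) + η (P.face (P.cut i))) := fun i => by
      rw [twist_cut, twist_rev_cut, left_face, P.left_cut, (h2 i).1, (h2 i).2, hflux,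
        inv_one, one_smul, inv_smul_eq_iff, Units.smul_def, Fin.val_castSucc]
      module
    have key2 : ∀ i, (P.twist x (Dart.rev (P.cut i)))⁻¹ •
        (u (P.left (Dart.rev (P.cut i))) - u (P.path 0) + η (Dart.rev (P.cut i))) =
        (P.twist x (P.cut i))⁻¹ •
          (u (P.left (P.face (Dart.rev (P.cut i)))) - u (P.path 0) +
            η (P.face (Dart.rev (P.cut i)))) := fun i => by
      rw [twist_cut, twist_rev_cut, left_face, P.right_cut, (h3 i).1, (h3 i).2, hflux,
        inv_one, one_smul, eq_inv_smul_iff, Units.smul_def, Fin.val_succ]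
      module
    intro d
    by_cases hd : d ∈ Set.range P.cut
    · obtain ⟨j, rfl⟩ := hd
      exact key1 j
    by_cases hd' : Dart.rev d ∈ Set.range P.cut
    · obtain ⟨j, hj⟩ := hd'
      obtain rfl : d = Dart.rev (P.cut j) := by rw [hj, Dart.rev_rev]
      rw [Dart.rev_rev]
      exact key2 j
    · dsimp only
      rw [h1 d hd hd', left_face]
      simp [twist, hd, hd']
  · have hfl : ∀ n, P.flux f n ∈ S := fun n =>
      Submodule.sum_mem _ fun j _ => by split_ifs; exacts [hS _, S.zero_mem]
    rw [add_sub_cancel_left]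
    obtain ⟨n, h | h⟩ := h4 d
    · rw [h]; exact S.zero_mem
    · rw [h]; exact S.neg_mem (S.smul_mem _ (hfl n))

end AnnularEmbedding

theorem LinkDiagram.sum_alexanderMatrix_smul {S X : Type*} (D : LinkDiagram S X) [Fintype D.Arc]
    {A W : Type*} [CommRing A] [AddCommGroup W] [Module A W]
    (σ : MvLaurent D.Component →+* A) (t : D.Component → Aˣ)
    (ht : ∀ c : D.Component, σ (MvLaurent.var c : MvLaurent D.Component) = t c)
    (a : D.Arc → W) (c : X) :
    ∑ j, σ (D.alexanderMatrix c j) • a j =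
      if D.sign c = 1 then
        (((t (D.component (D.overIn c)))⁻¹ : Aˣ) * ((t (D.component (D.underIn c)) : A) - 1)) •
            a (D.arc (D.overIn c)) +
          (((t (D.component (D.overIn c)))⁻¹ : Aˣ) : A) • a (D.arc (D.underIn c)) -
          a (D.arc (D.next (D.underIn c)))
      else
        (1 - (t (D.component (D.underIn c)) : A)) • a (D.arc (D.overIn c)) +
          (t (D.component (D.overIn c)) : A) • a (D.arc (D.underIn c)) -
          a (D.arc (D.next (D.underIn c))) := by
  classical
  have hinv : ∀ c : D.Component,
      σ ((MvLaurent.var c)⁻¹ : (MvLaurent D.Component)ˣ) = ((t c)⁻¹ : Aˣ) := fun c => by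
    have h1 : Units.map σ.toMonoidHom (MvLaurent.var c) = t c := Units.ext (ht c)
    rw [← h1, ← map_inv]
    rfl
  have hsingle : ∀ b : D.Arc, ∑ j, σ ((Pi.single b 1 : D.Arc → MvLaurent D.Component) j) • a j =
      a b := fun b => by
    simp [Pi.single_apply, apply_ite σ, ite_smul]
  have hrow : ∀ j, D.alexanderMatrix c j = _ := congrFun (D.alexanderMatrix_row c)
  simp only [hrow]
  split_ifs <;>
  simp only [Pi.add_apply, Pi.sub_apply, Pi.smul_apply, smul_eq_mul, map_add, map_sub, map_mul,
    hinv, ht, add_smul, sub_smul, Finset.sum_add_distrib, Finset.sum_sub_distrib,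
    mul_smul, ← Finset.smul_sum, hsingle, one_smul]

/-! ### Colorings: the Alexander system at t_i = -1 and t_C = x. -/

namespace AnnularEmbedding

variable {V E R : Type*} [Fintype V] [Fintype E] [Fintype R] {G : PeriodicGraph V E}
  {P : AnnularEmbedding G R} (o : P.Orientation)

/-- The unit `x`. -/
def unitX : ℤ[T;T⁻¹]ˣ := (LaurentPolynomial.isUnit_T (R := ℤ) 1).unit

open Classical in
theorem specialize_var (c : (encircledLink o).Component) :
    specialize o (MvLaurent.var c : MvLaurent (encircledLink o).Component) =
      ((if c = circle o then unitX else -1 : ℤ[T;T⁻¹]ˣ) : ℤ[T;T⁻¹]) := by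
  rw [specialize, MvLaurent.eval_var]
  rfl

variable {A W : Type*} [CommRing A] [AddCommGroup W] [Module A W] (x : Aˣ)

/-- Colorings of the segments by the specialized Alexander module in which the overpassing part of
the meridian has color zero. -/
structure IsColoring (P : AnnularEmbedding G R) (α : P.Segment → W) : Prop where
  front : ∀ j, α (.front j) = 0
  back_zero : α (.back 0) = 0
  back_last : α (.back (Fin.last _)) = 0
  strand_one : ∀ d, α (.strand d 1) = α (.strand d 0)
  strand_three : ∀ d, α (.strand d 3) = α (.strand d 4)
  strand_two : ∀ d, α (.strand d 2) = P.twist x d • α (.strand d 1)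
  strand_two' : ∀ d, α (.strand d 2) = P.twist x (P.rot d) • α (.strand d 3)
  first_back : ∀ i : Fin P.k, α (.back ⟨2 * i, by omega⟩) + α (.back ⟨2 * i + 1, by omega⟩) =
    (1 - (x : A)) • α (.strand (P.cut i) 0)
  second_back : ∀ i : Fin P.k,
    α (.back ⟨2 * i + 1, by omega⟩) + α (.back ⟨2 * i + 2, by omega⟩) =
    (1 - (x : A)) • α (.strand (P.rot.symm (P.cut i)) 4)
  edge_pos : ∀ d, G.sign d.1 = 1 → α (.strand (Dart.rev d) 0) = α (.strand d 0)
  edge_neg : ∀ d, G.sign d.1 ≠ 1 →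
    α (.strand (P.rot.symm (Dart.rev d)) 4) = α (.strand (P.rot.symm d) 4)
  edge_sum : ∀ d, α (.strand d 0) + α (.strand (Dart.rev d) 0) =
    α (.strand (P.rot.symm d) 4) + α (.strand (P.rot.symm (Dart.rev d)) 4)

theorem strand_mem_range_underSegment (d : E × Bool) (j : Fin 5) :
    (.strand d j : P.Segment) ∈ Set.range (underSegment o) ↔
      (d ∈ Set.range P.cut ∧ j = if o.dir d then 1 else 2) ∨
      (P.rot d ∈ Set.range P.cut ∧ j = if o.dir d then 2 else 3) ∨
      (o.dir d = false ∧ j = 0 ∧ G.sign d.1 ≠ 1) ∨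
      (o.dir d = true ∧ j = 4 ∧ G.sign (P.rot d).1 = 1) := by
  constructor
  · rintro ⟨e | i | i | i | i, h⟩ <;> simp only [underSegment] at h
    · obtain ⟨d₁, d₂, hd, h1, h2, h3, h4, h5⟩ := exists_strands o e
      rw [h3, h4] at h
      have h6 : (P.rot d₂).1 = e := by
        rcases h5 with ⟨h5, -⟩ | ⟨h5, -⟩
        · rw [h5, hd]
        · rw [h5, ← hd]; rfl
      split_ifs at h with hs <;> cases h
      · exact Or.inr (Or.inr (Or.inr ⟨h2, rfl, h6 ▸ hs⟩))
      · exact Or.inr (Or.inr (Or.inl ⟨h1, rfl, hd ▸ hs⟩))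
    · cases h; exact Or.inl ⟨⟨i, rfl⟩, rfl⟩
    · cases h
    · cases h; exact Or.inr (Or.inl ⟨⟨i, by simp⟩, rfl⟩)
    · cases h
  · rintro (⟨⟨i, rfl⟩, rfl⟩ | ⟨⟨i, hi⟩, rfl⟩ | ⟨h, rfl, hs⟩ | ⟨h, rfl, hs⟩)
    · exact ⟨.firstFront i, rfl⟩
    · obtain rfl : d = P.rot.symm (P.cut i) := by rw [hi, Equiv.symm_apply_apply]
      exact ⟨.secondFront i, rfl⟩
    · exact ⟨.edge d.1, by rw [← firstIn_of_not_dir h]; simp [underSegment, hs]⟩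
    · exact ⟨.edge (P.rot d).1, by rw [← secondIn_of_dir h]; simp [underSegment, hs]⟩

theorem front_notMem_range_underSegment (j : Fin (2 * P.k + 1)) :
    (.front j : P.Segment) ∉ Set.range (underSegment o) := by
  rintro ⟨e | i | i | i | i, h⟩ <;> simp only [underSegment] at h
  · split_ifs at h <;> simp [firstIn, secondIn] at h
  all_goals cases h

theorem back_zero_notMem_range_underSegment :
    (.back 0 : P.Segment) ∉ Set.range (underSegment o) := by
  rintro ⟨e | i | i | i | i, h⟩ <;> simp only [underSegment] at h
  · split_ifs at h <;> simp [firstIn, secondIn] at h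
  all_goals cases h

/-- The coloring relation of a crossing for the specialized Alexander matrix. -/
def CrossingRelation (α : P.Segment → W) : P.Crossing → Prop
  | .edge e => α (underSegment o (.edge e)) + α (nextSegment o (underSegment o (.edge e))) =
      (2 : A) • α (overSegment o (.edge e))
  | .firstFront i => α (.strand (P.cut i) 2) = x • α (.strand (P.cut i) 1)
  | .secondFront i =>
      α (.strand (P.rot.symm (P.cut i)) 2) = x • α (.strand (P.rot.symm (P.cut i)) 3)
  | .firstBack i => α (.back ⟨2 * i, by omega⟩) + α (.back ⟨2 * i + 1, by omega⟩) =
      (1 - (x : A)) • α (overSegment o (.firstBack i))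
  | .secondBack i => α (.back ⟨2 * i + 1, by omega⟩) + α (.back ⟨2 * i + 2, by omega⟩) =
      (1 - (x : A)) • α (overSegment o (.secondBack i))

/-- At t = -1 the crossing sign and the orientations drop out of the relations where a medial strand
is over. Under the front of C, whose color is zero, the relation becomes multiplication by x or its
inverse, and sign and direction combine to one form. -/
theorem sum_alexanderMatrix_eq_zero_iff [Module ℤ[T;T⁻¹] W] [Fintype (encircledLink o).Arc]
    (a : (encircledLink o).Arc → W) (α : P.Segment → W)
    (ha : ∀ s, a ((encircledLink o).arc s) = α s)
    (hα : ∀ j, α (.front j) = 0) (c : P.Crossing) :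
    ∑ j, specialize o ((encircledLink o).alexanderMatrix c j) • a j = 0 ↔
      CrossingRelation o unitX α c := by
  classical
  obtain ⟨t, ht, hC, hne⟩ : ∃ t : (encircledLink o).Component → ℤ[T;T⁻¹]ˣ,
      (∀ c, specialize o (MvLaurent.var c : MvLaurent (encircledLink o).Component) = t c) ∧
      t (circle o) = unitX ∧ ∀ c ≠ circle o, t c = -1 :=
    ⟨_, specialize_var o, if_pos rfl, fun c hc => if_neg hc⟩
  rw [(encircledLink o).sum_alexanderMatrix_smul (specialize o) t ht]
  simp only [ha, encircledLink_next, encircledLink_overIn, encircledLink_underIn,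
    encircledLink_sign]
  have hs : ∀ d j, t ((encircledLink o).component (.strand d j)) = -1 := fun d j => by
    rw [component_strand]
    exact hne _ (strandComponent_ne_circle o d)
  have hf : ∀ j, t ((encircledLink o).component (.front j)) = unitX := fun j => by
    rw [component_front, hC]
  have hb : ∀ j, t ((encircledLink o).component (.back j)) = unitX := fun j => by
    rw [component_back, hC]
  have hone : ((-1 : ℤ[T;T⁻¹]ˣ)⁻¹ : ℤ[T;T⁻¹]ˣ) = -1 := by rw [inv_neg, inv_one]
  rcases c with e | i | i | i | i
  · obtain ⟨d₁, d₂, -, -, -, h1, h2, -⟩ := exists_strands o e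
    have h3 : t ((encircledLink o).component (overSegment o (.edge e))) = -1 := by
      simp only [overSegment]; split_ifs <;> simp only [h1, h2, hs]
    have h4 : t ((encircledLink o).component (underSegment o (.edge e))) = -1 := by
      simp only [underSegment]; split_ifs <;> simp only [h1, h2, hs]
    rw [h3, h4, hone, CrossingRelation, Units.val_neg, Units.val_one, eq_comm (b := (2 : ℤ[T;T⁻¹]) • _),
      ← sub_eq_zero (a := (2 : ℤ[T;T⁻¹]) • _)]
    split_ifs <;> apply Eq.congr_left <;> module
  · simp only [overSegment, hf, hα, CrossingRelation, smul_zero, zero_add]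
    cases h : o.dir (P.cut i)
    · obtain ⟨-, -, n1, -⟩ := next_strand_of_not_dir h
      simp only [crossingSign, underSegment, h, n1, if_true, Bool.false_eq_true, if_false]
      rw [sub_eq_zero, ← Units.smul_def, inv_smul_eq_iff]
    · obtain ⟨-, n1, -⟩ := next_strand_of_dir h
      simp only [crossingSign, underSegment, h, n1, if_true]
      rw [if_neg (by decide), sub_eq_zero, ← Units.smul_def, eq_comm]
  · have n1 : nextSegment o (.back ⟨2 * i + 1, by omega⟩) = .back ⟨2 * i, by omega⟩ := by
      simp [nextSegment]
    have h3 : t ((encircledLink o).component (overSegment o (.firstBack i))) = -1 := hs _ _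
    rw [h3, hone, CrossingRelation, Units.val_neg, Units.val_one,
      eq_comm (b := (1 - (unitX : ℤ[T;T⁻¹])) • _), ← sub_eq_zero (a := (1 - (unitX : ℤ[T;T⁻¹])) • _)]
    simp only [underSegment, hb, n1]
    split_ifs <;> apply Eq.congr_left <;> module
  · simp only [overSegment, hf, hα, CrossingRelation, smul_zero, zero_add]
    cases h : o.dir (P.rot.symm (P.cut i))
    · obtain ⟨-, n1, -⟩ := next_strand_of_not_dir h
      simp only [crossingSign, underSegment, h, n1, Bool.false_eq_true, if_false]
      rw [if_neg (by decide), sub_eq_zero, ← Units.smul_def, eq_comm]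
    · obtain ⟨-, -, n1, -⟩ := next_strand_of_dir h
      simp only [crossingSign, underSegment, h, n1, if_true]
      rw [sub_eq_zero, ← Units.smul_def, inv_smul_eq_iff]
  · have n1 : nextSegment o (.back ⟨2 * i + 2, by omega⟩) = .back ⟨2 * i + 1, by omega⟩ := by
      simp [nextSegment]
    have h3 : t ((encircledLink o).component (overSegment o (.secondBack i))) = -1 := hs _ _
    rw [h3, hone, CrossingRelation, Units.val_neg, Units.val_one,
      eq_comm (b := (1 - (unitX : ℤ[T;T⁻¹])) • _), ← sub_eq_zero (a := (1 - (unitX : ℤ[T;T⁻¹])) • _)]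
    simp only [underSegment, hb, n1]
    split_ifs <;> apply Eq.congr_left <;> module

/-- Colorings of the arcs are the same as colorings of the segments. -/
theorem isColoring_of_crossingRelation {α : P.Segment → W}
    (hj : ∀ s, s ∉ Set.range (underSegment o) → α (nextSegment o s) = α s)
    (h0 : α (.front 0) = 0) (hc : ∀ c, CrossingRelation o x α c) : IsColoring x P α := by
  have hfront : ∀ j, α (.front j) = 0 := by
    rintro ⟨j, hjk⟩
    induction j with
    | zero => exact h0
    | succ j ih =>
      have := hj _ (front_notMem_range_underSegment o ⟨j, by omega⟩)
      rw [ih (by omega)] at this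
      simpa [nextSegment, show j < 2 * P.k by omega] using this
  have hlast : α (.back (Fin.last _)) = 0 := by
    have := hj _ (front_notMem_range_underSegment o (Fin.last _))
    rw [hfront] at this
    simpa [nextSegment] using this
  have hzero : α (.back 0) = 0 := by
    have := hj _ (back_zero_notMem_range_underSegment o)
    simpa [nextSegment, hfront] using this.symm
  have hstrand : ∀ d j, ¬ ((d ∈ Set.range P.cut ∧ j = if o.dir d then 1 else 2) ∨
      (P.rot d ∈ Set.range P.cut ∧ j = if o.dir d then 2 else 3) ∨
      (o.dir d = false ∧ j = 0 ∧ G.sign d.1 ≠ 1) ∨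
      (o.dir d = true ∧ j = 4 ∧ G.sign (P.rot d).1 = 1)) →
      α (nextSegment o (.strand d j)) = α (.strand d j) := fun d j h =>
    hj _ fun hu => h ((strand_mem_range_underSegment o d j).1 hu)
  have h01 : ∀ d, α (.strand d 1) = α (.strand d 0) := fun d => by
    cases h : o.dir d
    · have := hstrand d 1 (by simp [h])
      rw [(next_strand_of_not_dir h).2.2.2.1] at this
      exact this.symm
    · have := hstrand d 0 (by simp [h])
      rwa [(next_strand_of_dir h).1] at this
  have h34 : ∀ d, α (.strand d 3) = α (.strand d 4) := fun d => by
    cases h : o.dir d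
    · have := hstrand d 4 (by simp [h])
      rwa [(next_strand_of_not_dir h).1] at this
    · have := hstrand d 3 (by simp [h])
      rw [(next_strand_of_dir h).2.2.2.1] at this
      exact this.symm
  have hfirst : ∀ d, o.dir d = false → G.sign d.1 = 1 →
      α (.strand (Dart.rev d) 0) = α (.strand d 0) := fun d h hs => by
    rw [← (next_strand_of_not_dir h).2.2.2.2]
    exact hstrand d 0 (by simp [h, hs])
  have hsecond : ∀ d, o.dir (P.rot.symm d) = true → G.sign d.1 ≠ 1 →
      α (.strand (P.rot.symm (Dart.rev d)) 4) = α (.strand (P.rot.symm d) 4) := fun d h hs => by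
    have := (next_strand_of_dir h).2.2.2.2
    rw [Equiv.apply_symm_apply] at this
    rw [← this]
    exact hstrand _ 4 (by simp [h, hs])
  have hpos : ∀ d, G.sign d.1 = 1 → α (.strand (Dart.rev d) 0) = α (.strand d 0) := fun d hs => by
    cases h : o.dir d
    · exact hfirst d h hs
    · have := hfirst (Dart.rev d) (by rw [o.dir_first, h]; rfl) hs
      rw [Dart.rev_rev] at this
      exact this.symm
  have hneg : ∀ d, G.sign d.1 ≠ 1 →
      α (.strand (P.rot.symm (Dart.rev d)) 4) = α (.strand (P.rot.symm d) 4) := fun d hs => by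
    cases h : o.dir (P.rot.symm d)
    · have := hsecond (Dart.rev d) (by rw [o.dir_second, h]; rfl) hs
      rw [Dart.rev_rev] at this
      exact this.symm
    · exact hsecond d h hs
  refine ⟨hfront, hzero, hlast, h01, h34, fun d => ?_, fun d => ?_, fun i => ?_, fun i => ?_,
    hpos, hneg, fun d => ?_⟩
  · by_cases hd : d ∈ Set.range P.cut
    · obtain ⟨i, rfl⟩ := hd
      rw [twist_cut]
      exact hc (.firstFront i)
    · rw [twist, if_neg hd, one_smul]
      cases h : o.dir d
      · have := hstrand d 2 (by simp [h, hd])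
        rw [(next_strand_of_not_dir h).2.2.1] at this
        exact this.symm
      · have := hstrand d 1 (by simp [h, hd])
        rwa [(next_strand_of_dir h).2.1] at this
  · by_cases hd : P.rot d ∈ Set.range P.cut
    · obtain ⟨i, hi⟩ := hd
      obtain rfl : d = P.rot.symm (P.cut i) := by rw [hi, Equiv.symm_apply_apply]
      rw [Equiv.apply_symm_apply, twist_cut]
      exact hc (.secondFront i)
    · rw [twist, if_neg hd, one_smul]
      cases h : o.dir d
      · have := hstrand d 3 (by simp [h, hd])
        rwa [(next_strand_of_not_dir h).2.1] at this
      · have := hstrand d 2 (by simp [h, hd])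
        rw [(next_strand_of_dir h).2.2.1] at this
        exact this.symm
  · have := hc (.firstBack i)
    simp only [CrossingRelation, overSegment] at this
    rw [this]
    split_ifs <;> simp only [h01]
  · have := hc (.secondBack i)
    simp only [CrossingRelation, overSegment] at this
    rw [this]
    split_ifs <;> simp only [h34]
  -- The over color occurs on both halves of the over strand, so twice the over color is the sum
  -- over these halves.
  · obtain ⟨d₁, d₂, e1, e2, e3, e4, e5, e6⟩ := exists_strands o d.1
    have key := hc (.edge d.1)
    simp only [CrossingRelation, overSegment, underSegment, e4, e5] at key
    have hd : d₁ = d ∨ d₁ = Dart.rev d := by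
      rcases d with ⟨e, _ | _⟩ <;> rcases d₁ with ⟨e', _ | _⟩ <;> simp_all [Dart.rev]
    have hd' : d₂ = P.rot.symm d ∨ d₂ = P.rot.symm (Dart.rev d) := by
      rcases e6 with ⟨e6, -⟩ | ⟨e6, -⟩ <;> rcases hd with rfl | rfl <;>
        rw [← Equiv.symm_apply_apply P.rot d₂, e6] <;> simp [Dart.rev_rev]
    by_cases hs : G.sign d.1 = 1
    · simp only [hs, if_true, (next_strand_of_dir e3).2.2.2.2] at key
      have h1 := hpos d hs
      rw [h1, ← two_smul A, show α (.strand d 0) = α (.strand d₁ 0) by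
        rcases hd with rfl | rfl
        · rfl
        · exact h1.symm, ← key]
      rcases hd' with rfl | rfl
      · rw [Equiv.apply_symm_apply]
      · rw [Equiv.apply_symm_apply, Dart.rev_rev, add_comm]
    · simp only [hs, if_false, (next_strand_of_not_dir e2).2.2.2.2] at key
      have h1 := hneg d hs
      rw [h1, ← two_smul A, show α (.strand (P.rot.symm d) 4) = α (.strand d₂ 4) by
        rcases hd' with rfl | rfl
        · rfl
        · exact h1.symm, ← key]
      rcases hd with rfl | rfl
      · rfl
      · rw [Dart.rev_rev, add_comm]

variable {x}

/-- Together with `IsColoring.crossingRelation` this is the converse of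
`isColoring_of_crossingRelation`: a coloring is constant on arcs and so descends to them. -/
theorem IsColoring.apply_next {α : P.Segment → W} (h : IsColoring x P α) (s : P.Segment)
    (hs : s ∉ Set.range (underSegment o)) : α (nextSegment o s) = α s := by
  rcases s with ⟨d, j⟩ | ⟨j, hj⟩ | ⟨j, hj⟩
  · rw [strand_mem_range_underSegment] at hs
    have htw : d ∉ Set.range P.cut → α (.strand d 2) = α (.strand d 1) := fun hd => by
      rw [h.strand_two, twist, if_neg hd, one_smul]
    have htw' : P.rot d ∉ Set.range P.cut → α (.strand d 2) = α (.strand d 3) := fun hd => by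
      rw [h.strand_two', twist, if_neg hd, one_smul]
    have h01 := h.strand_one d
    have h34 := h.strand_three d
    cases hd : o.dir d
    · obtain ⟨n4, n3, n2, n1, n0⟩ := next_strand_of_not_dir hd
      have hp := h.edge_pos d
      rw [hd] at hs
      fin_cases j
      · exact (congrArg α n0).trans (hp (by_contra fun hn => hs (by simp [hn])))
      · exact (congrArg α n1).trans h01.symm
      · exact (congrArg α n2).trans (htw fun hn => hs (Or.inl ⟨hn, rfl⟩)).symm
      · exact (congrArg α n3).trans (htw' fun hn => hs (Or.inr (Or.inl ⟨hn, rfl⟩)))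
      · exact (congrArg α n4).trans h34
    · obtain ⟨n0, n1, n2, n3, n4⟩ := next_strand_of_dir hd
      have hp := h.edge_neg (P.rot d)
      rw [Equiv.symm_apply_apply] at hp
      rw [hd] at hs
      fin_cases j
      · exact (congrArg α n0).trans h01
      · exact (congrArg α n1).trans (htw fun hn => hs (Or.inl ⟨hn, rfl⟩))
      · exact (congrArg α n2).trans (htw' fun hn => hs (Or.inr (Or.inl ⟨hn, rfl⟩))).symm
      · exact (congrArg α n3).trans h34.symm
      · exact (congrArg α n4).trans (hp fun hn => hs (by simp [hn]))
  · rw [h.front, nextSegment]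
    split_ifs with hlt
    · exact h.front _
    · obtain rfl : j = 2 * P.k := by simp at hlt; omega
      exact h.back_last
  · have hjk : j = 0 := by
      by_contra hne
      rcases Nat.even_or_odd' j with ⟨i, rfl | rfl⟩
      · obtain ⟨i, rfl⟩ := Nat.exists_eq_succ_of_ne_zero (show i ≠ 0 by omega)
        exact hs ⟨.secondBack ⟨i, by omega⟩, rfl⟩
      · exact hs ⟨.firstBack ⟨i, by omega⟩, rfl⟩
    subst hjk
    rw [show (.back ⟨0, hj⟩ : P.Segment) = .back 0 from rfl, h.back_zero]
    simp [nextSegment, h.front]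

theorem IsColoring.crossingRelation {α : P.Segment → W} (h : IsColoring x P α) (c : P.Crossing) :
    CrossingRelation o x α c := by
  rcases c with e | i | i | i | i
  · obtain ⟨d₁, d₂, e1, e2, e3, e4, e5, e6⟩ := exists_strands o e
    simp only [CrossingRelation, overSegment, underSegment, e4, e5]
    have hsum := h.edge_sum d₁
    have h6 : P.rot d₂ = d₁ ∨ P.rot d₂ = Dart.rev d₁ := e6.imp And.left And.left
    have hsum' : α (.strand d₁ 0) + α (.strand (Dart.rev d₁) 0) =
        α (.strand d₂ 4) + α (.strand (P.rot.symm (Dart.rev (P.rot d₂))) 4) := by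
      rw [hsum]
      rcases h6 with h6 | h6
      · rw [← h6, Equiv.symm_apply_apply]
      · rw [h6, Dart.rev_rev, ← h6, Equiv.symm_apply_apply, add_comm]
    by_cases hs : G.sign e = 1
    · simp only [hs, if_true, (next_strand_of_dir e3).2.2.2.2]
      rw [← hsum', h.edge_pos d₁ (e1 ▸ hs), two_smul]
    · simp only [hs, if_false, (next_strand_of_not_dir e2).2.2.2.2]
      have hs' : G.sign (P.rot d₂).1 ≠ 1 := by
        rcases h6 with h6 | h6 <;> rw [h6] <;> exact e1 ▸ hs
      have := h.edge_neg (P.rot d₂) hs'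
      rw [Equiv.symm_apply_apply] at this
      rw [hsum', this, two_smul]
  · exact (h.strand_two _).trans (by rw [twist_cut])
  · simp only [CrossingRelation, overSegment]
    rw [h.first_back]
    split_ifs <;> simp only [h.strand_one]
  · have := h.strand_two' (P.rot.symm (P.cut i))
    rwa [Equiv.apply_symm_apply, twist_cut] at this
  · simp only [CrossingRelation, overSegment]
    rw [h.second_back]
    split_ifs <;> simp only [h.strand_three]

end AnnularEmbedding

open Classical in
/-- On each cycle of a permutation, a function with sum zero is a difference. -/
theorem Equiv.Perm.exists_sub_eq_of_sum_eq_zero {α ι W : Type*} [Fintype α] [AddCommGroup W]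
    (φ : Equiv.Perm α) (π : α → ι) (hφ : ∀ a b, π a = π b → φ.SameCycle a b)
    (F : α → W) (hF : ∀ i, ∑ a, (if π a = i then F a else 0) = 0) :
    ∃ m : α → W, ∀ a, m a - m (φ.symm a) = F a := by
  let Ψ : (α → W) →+ (α → W) :=
    { toFun := fun m a => m a - m (φ.symm a)
      map_zero' := by ext; simp
      map_add' := fun m m' => by ext; simp; abel }
  suffices h : F ∈ Ψ.range by
    obtain ⟨m, hm⟩ := h
    exact ⟨m, fun a => congrFun hm a⟩
  have hstep : ∀ a w, Pi.single a w - Pi.single (φ a) w ∈ Ψ.range := fun a w => by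
    refine ⟨Pi.single a w, ?_⟩
    ext b
    simp only [Ψ, AddMonoidHom.coe_mk, ZeroHom.coe_mk, Pi.sub_apply, Pi.single_apply,
      Equiv.symm_apply_eq]
  have hcycle : ∀ a b w, π a = π b → Pi.single a w - Pi.single b w ∈ Ψ.range := by
    intro a b w hab
    obtain ⟨n, rfl⟩ := (hφ a b hab).exists_nat_pow_eq
    clear hab
    induction n with
    | zero => simp
    | succ n ih =>
      have := Ψ.range.add_mem ih (hstep ((φ ^ n) a) w)
      rwa [sub_add_sub_cancel, ← Equiv.Perm.mul_apply, ← pow_succ'] at this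
  rcases isEmpty_or_nonempty α with hα | hα
  · exact ⟨0, Subsingleton.elim _ _⟩
  -- A base point in each nonempty fiber of π, hence on each cycle. All values of F are transported
  -- to the base points, where they cancel by `hF`.
  let b : ι → α := fun i => if h : ∃ a, π a = i then h.choose else Classical.arbitrary α
  have hb : ∀ a, π (b (π a)) = π a := fun a => by
    have hex : ∃ a', π a' = π a := ⟨a, rfl⟩
    simp only [b, dif_pos hex]
    exact hex.choose_spec
  have hzero : ∑ a, (Pi.single (b (π a)) (F a) : α → W) = 0 := by
    rw [← Finset.sum_fiberwise_of_maps_to (t := Finset.univ.image π) (g := π)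
      (fun a _ => Finset.mem_image_of_mem _ (Finset.mem_univ a))]
    apply Finset.sum_eq_zero
    intro i _
    have h1 : ∑ a with π a = i, (Pi.single (b (π a)) (F a) : α → W) =
        ∑ a with π a = i, Pi.single (b i) (F a) :=
      Finset.sum_congr rfl fun a ha => by rw [(Finset.mem_filter.1 ha).2]
    have h2 := hF i
    rw [← Finset.sum_filter] at h2
    have h3 := map_sum (AddMonoidHom.single (fun _ : α => W) (b i)) F {a | π a = i}
    rw [h2, map_zero] at h3
    rw [h1]
    exact h3.symm
  have hsum : F = ∑ a, (Pi.single a (F a) - Pi.single (b (π a)) (F a)) := by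
    rw [Finset.sum_sub_distrib, hzero, sub_zero]
    ext a
    simp [Finset.sum_apply, Pi.single_apply]
  rw [hsum]
  exact AddSubgroup.sum_mem _ fun a _ => hcycle _ _ _ (hb a).symm

/-! ### Colorings and harmonic functions. -/

namespace AnnularEmbedding

variable {V E R : Type*} [Fintype V] [Fintype E] [Fintype R] {G : PeriodicGraph V E}
  {P : AnnularEmbedding G R}
variable {A W : Type*} [CommRing A] [AddCommGroup W] [Module A W] {x : Aˣ}

/-- The difference of a twisted function along a directed edge. -/
def twistedDiff (P : AnnularEmbedding G R) (x : Aˣ) (w : V → W) (d : E × Bool) : W :=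
  w (G.start d) - (P.twist x d * (P.twist x (Dart.rev d))⁻¹) • w (G.start (Dart.rev d))

open Classical in
/-- Vertex functions in the kernel of the twisted Laplacian. -/
def IsHarmonic (P : AnnularEmbedding G R) (x : Aˣ) (w : V → W) : Prop :=
  ∀ v, ∑ d, (if G.start d = v then (G.sign d.1 : ℤ) • P.twistedDiff x w d else 0) = 0

theorem twist_inv_smul_twistedDiff (w : V → W) (d : E × Bool) :
    (P.twist x d)⁻¹ • P.twistedDiff x w d = (P.twist x d)⁻¹ • w (G.start d) -
      (P.twist x (Dart.rev d))⁻¹ • w (G.start (Dart.rev d)) := by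
  rw [twistedDiff, smul_sub, smul_smul, inv_mul_cancel_left]

theorem twistedDiff_mem {S : Submodule A W} {w : V → W} (hw : ∀ v, w v ∈ S) (d : E × Bool) :
    P.twistedDiff x w d ∈ S :=
  S.sub_mem (hw _) (S.smul_mem ((P.twist x d * (P.twist x (Dart.rev d))⁻¹ : Aˣ) : A) (hw _))

/-- The function w is the vertex part of the middle colors m. The sign of an edge tells which strand
keeps its color at the crossing, and this identifies the jump f with ∓ the twisted difference of w.
The jumps of m around a vertex telescope, so w is harmonic. -/
theorem IsColoring.exists_isHarmonic {α : P.Segment → W} (h : IsColoring x P α) :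
    ∃ w : V → W, P.IsHarmonic x w ∧
      ∀ S : Submodule A W, (∀ v, w v ∈ S) → ∀ s, α s ∈ S := by
  classical
  set m : E × Bool → W := fun d => α (.strand d 2) with hmdef
  have hzero : ∀ d, α (.strand d 0) = (P.twist x d)⁻¹ • m d := fun d => by
    rw [hmdef]
    dsimp only
    rw [h.strand_two, inv_smul_smul, h.strand_one]
  have hfour : ∀ d, α (.strand (P.rot.symm d) 4) = (P.twist x d)⁻¹ • m (P.rot.symm d) := fun d => by
    rw [hmdef]
    dsimp only
    rw [h.strand_two', Equiv.apply_symm_apply, inv_smul_smul, h.strand_three]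
  let f : E × Bool → W := fun d => α (.strand d 0) - α (.strand (P.rot.symm d) 4)
  have hf : ∀ d, f (Dart.rev d) = -f d := fun d => by
    have := h.edge_sum d
    rw [← sub_eq_zero] at this
    rw [eq_neg_iff_add_eq_zero, ← this]
    simp only [f]
    abel
  have hm : ∀ d, m d - m (P.rot.symm d) = P.twist x d • f d := fun d => by
    simp only [f, hzero, hfour, smul_sub, smul_inv_smul]
  obtain ⟨w, ρ, u, hu, hw, hρ, hS⟩ := P.exists_twisted_potential hf hm
  have hg : ∀ d, α (.strand d 0) - α (.strand (P.rot.symm (Dart.rev d)) 4) =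
      (P.twist x d)⁻¹ • P.twistedDiff x w d := fun d => by
    rw [twist_inv_smul_twistedDiff, hzero, hfour, hw, hw, P.start_rot_symm, smul_add, smul_add,
      ← P.face_apply, hρ]
    abel
  have hfg : ∀ d, P.twist x d • f d = -((G.sign d.1 : ℤ) • P.twistedDiff x w d) := fun d => by
    have h1 := hg d
    rw [eq_inv_smul_iff] at h1
    rw [← h1]
    rcases Int.units_eq_one_or (G.sign d.1) with hs | hs
    · have h2 := h.edge_pos d hs
      have h3 := h.edge_sum d
      rw [h2, ← sub_eq_zero] at h3
      rw [hs, Units.val_one, one_smul, ← smul_neg]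
      congr 1
      rw [← sub_eq_zero, ← h3]
      simp only [f]
      abel
    · have h2 := h.edge_neg d (by rw [hs]; decide)
      rw [hs, Units.val_neg, Units.val_one, neg_smul, one_smul, neg_neg, h2]
  refine ⟨w, fun v => ?_, fun S hwS => ?_⟩
  · have h1 : ∑ d, (if G.start d = v then m d - m (P.rot.symm d) else 0) = 0 := by
      have : ∀ d, (if G.start d = v then m d - m (P.rot.symm d) else 0) =
          (if G.start d = v then m d else 0) -
            if G.start d = v then m (P.rot.symm d) else 0 := fun d => by
        split_ifs <;> simp
      simp only [this, Finset.sum_sub_distrib]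
      rw [sub_eq_zero, ← Equiv.sum_comp P.rot.symm]
      simp only [P.start_rot_symm]
    simp only [hm, hfg] at h1
    refine neg_eq_zero.1 ?_
    rw [← Finset.sum_neg_distrib]
    refine (Finset.sum_congr rfl fun d _ => ?_).trans h1
    split_ifs <;> simp
  · have hFS : ∀ d, P.twist x d • f d ∈ S := fun d => by
      rw [hfg]
      exact S.neg_mem (S.smul_of_tower_mem _ (twistedDiff_mem hwS d))
    have hfS : ∀ d, f d ∈ S := fun d => by
      rw [← inv_smul_smul (P.twist x d) (f d)]
      exact S.smul_mem (((P.twist x d)⁻¹ : Aˣ) : A) (hFS d)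
    have hρu := hS S hfS
    -- The vertex part cancels in m (rot d) - m d, which lies in S. So membership of u in S spreads
    -- around each vertex, starting from u = 0 at `path 0`.
    have hrot : ∀ d, (u (P.left (P.rot d)) ∈ S) = (u (P.left d) ∈ S) := fun d => by
      have h1 := hFS (P.rot d)
      rw [← hm, hw, hw, Equiv.symm_apply_apply, P.start_rot, add_sub_add_left_eq_sub] at h1
      have h2 := S.sub_mem h1 (S.sub_mem (hρu (P.rot d)) (hρu d))
      have h3 : ρ (P.rot d) - ρ d - (ρ (P.rot d) - u (P.left (P.rot d)) - (ρ d - u (P.left d))) =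
          u (P.left (P.rot d)) - u (P.left d) := by abel
      rw [h3] at h2
      rw [eq_iff_iff]
      exact ⟨fun h => (S.sub_mem_iff_right h).1 h2, fun h => (S.sub_mem_iff_left h).1 h2⟩
    have huS := P.induction_of_connected (x₀ := Sum.inr (P.path 0))
      (p := Sum.elim (fun v => ∀ d, G.start d = v → u (P.left d) ∈ S) fun r => u r ∈ S)
      (by simp [hu]) fun d => ⟨fun hd => hd d rfl, fun hd d' hd' => by
        have : (u (P.left d') ∈ S) = (u (P.left d) ∈ S) :=
          P.apply_eq_of_rot (y := fun d => u (P.left d) ∈ S) hrot hd'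
        rw [this]
        exact hd⟩
    have hmS : ∀ d, m d ∈ S := fun d => by
      rw [hw, ← sub_add_cancel (ρ d) (u (P.left d))]
      exact S.add_mem (hwS _) (S.add_mem (hρu d) (huS (Sum.inr _)))
    have h0S : ∀ d, α (.strand d 0) ∈ S := fun d => by
      rw [hzero]
      exact S.smul_mem (((P.twist x d)⁻¹ : Aˣ) : A) (hmS d)
    have h4S : ∀ d, α (.strand d 4) ∈ S := fun d => by
      have := hfour (P.rot d)
      rw [Equiv.symm_apply_apply] at this
      rw [this]
      exact S.smul_mem (((P.twist x (P.rot d))⁻¹ : Aˣ) : A) (hmS d)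
    have hback : ∀ (j : ℕ) (hj : j < 2 * P.k + 1), α (.back ⟨j, hj⟩) ∈ S := by
      intro j
      induction j with
      | zero =>
        intro _
        exact h.back_zero ▸ S.zero_mem
      | succ j ih =>
        intro hj
        have ih := ih (by omega)
        rcases Nat.even_or_odd' j with ⟨i, rfl | rfl⟩
        · have := h.first_back ⟨i, by omega⟩
          rw [← eq_sub_iff_add_eq'] at this
          exact this ▸ S.sub_mem (S.smul_mem _ (h0S _)) ih
        · have := h.second_back ⟨i, by omega⟩
          rw [← eq_sub_iff_add_eq'] at this
          exact this ▸ S.sub_mem (S.smul_mem _ (h4S _)) ih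
    rintro (⟨d, j⟩ | j | ⟨j, hj⟩)
    · fin_cases j
      · exact h0S d
      · exact (h.strand_one d).symm ▸ h0S d
      · exact hmS d
      · exact (h.strand_three d).symm ▸ h4S d
      · exact h4S d
    · rw [h.front]
      exact S.zero_mem
    · exact hback j hj

/-- The edge relations prescribe the jumps f in terms of w. Harmonicity allows them to be integrated
around each vertex, and the twisted potential makes the integration constants at different vertices
compatible. -/
theorem IsHarmonic.exists_isColoring {w : V → W} (h : P.IsHarmonic x w) :
    ∃ α : P.Segment → W, IsColoring x P α ∧
      ∀ S : Submodule A W, (∀ s, α s ∈ S) → ∀ v, w v ∈ S := by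
  classical
  let f : E × Bool → W := fun d =>
    -((G.sign d.1 : ℤ) • ((P.twist x d)⁻¹ • P.twistedDiff x w d))
  have hf : ∀ d, f (Dart.rev d) = -f d := fun d => by
    have hs : G.sign (Dart.rev d).1 = G.sign d.1 := rfl
    simp only [f, twist_inv_smul_twistedDiff, Dart.rev_rev, hs]
    rw [neg_neg, ← smul_neg, neg_sub]
  obtain ⟨m₀, hm₀⟩ := P.rot.exists_sub_eq_of_sum_eq_zero G.start P.sameCycle_rot
    (fun d => P.twist x d • f d) fun v => by
      refine neg_eq_zero.1 ?_
      rw [← Finset.sum_neg_distrib]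
      refine (Finset.sum_congr rfl fun d _ => ?_).trans (h v)
      split_ifs
      · simp only [f, smul_neg, neg_neg]
        rw [smul_comm, smul_inv_smul]
      · simp
  obtain ⟨w₀, ρ, u, hu, hw₀, hρ, hS⟩ := P.exists_twisted_potential hf hm₀
  -- Replacing the vertex part `w₀` by the given w does not change the jumps around vertices.
  let m : E × Bool → W := fun d => w (G.start d) + ρ d
  have hm : ∀ d, m d - m (P.rot.symm d) = P.twist x d • f d := fun d => by
    rw [← hm₀, hw₀, hw₀, P.start_rot_symm]
    simp only [m, P.start_rot_symm]
    abel
  -- In the regions the color of the back of C is (x - 1) times the flux; in between it is forced by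
  -- the relation at `firstBack`. It returns to zero at the end because x - 1 kills the total flux.
  let back : ℕ → W := fun j =>
    if h : j % 2 = 1 ∧ j / 2 < P.k then
      (1 - (x : A)) • (x⁻¹ • m (P.cut ⟨j / 2, h.2⟩)) - ((x : A) - 1) • P.flux f (j / 2)
    else ((x : A) - 1) • P.flux f (j / 2)
  have hback0 : ∀ i, back (2 * i) = ((x : A) - 1) • P.flux f i := fun i => by
    simp only [back]
    rw [dif_neg (by omega), show 2 * i / 2 = i by omega]
  have hback1 : ∀ i : Fin P.k, back (2 * i + 1) =
      (1 - (x : A)) • (x⁻¹ • m (P.cut i)) - ((x : A) - 1) • P.flux f i := fun i => by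
    have h1 : (2 * (i : ℕ) + 1) / 2 = i := by omega
    simp only [back]
    rw [dif_pos ⟨by omega, by omega⟩]
    simp only [h1]
  have hfm : ∀ d, (P.twist x d)⁻¹ • m d - (P.twist x d)⁻¹ • m (P.rot.symm d) = f d := fun d => by
    rw [← smul_sub, hm, inv_smul_smul]
  have hgm : ∀ d, (P.twist x d)⁻¹ • m d -
      (P.twist x (Dart.rev d))⁻¹ • m (P.rot.symm (Dart.rev d)) =
      (P.twist x d)⁻¹ • P.twistedDiff x w d := fun d => by
    rw [twist_inv_smul_twistedDiff, ← P.face_apply]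
    simp only [m]
    rw [smul_add, smul_add, hρ, face_apply, P.start_rot_symm]
    abel
  have hsum : ∀ d, (P.twist x d)⁻¹ • m d + (P.twist x (Dart.rev d))⁻¹ • m (Dart.rev d) =
      (P.twist x d)⁻¹ • m (P.rot.symm d) +
      (P.twist x (Dart.rev d))⁻¹ • m (P.rot.symm (Dart.rev d)) := fun d => by
    have h1 := hf d
    rw [← hfm, ← hfm, eq_neg_iff_add_eq_zero] at h1
    rw [← sub_eq_zero, ← h1]
    abel
  refine ⟨fun s => match s with
    | .strand d j => if (j : ℕ) < 2 then (P.twist x d)⁻¹ • m d else if (j : ℕ) = 2 then m d else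
      (P.twist x (P.rot d))⁻¹ • m d
    | .front _ => 0
    | .back j => back j, ⟨fun _ => rfl, ?_, ?_, fun _ => rfl, fun _ => rfl, fun d => ?_,
      fun d => ?_, fun i => ?_, fun i => ?_, fun d hd => ?_, fun d hd => ?_, fun d => ?_⟩,
      fun S hαS => ?_⟩
  · exact (hback0 0).trans (by rw [flux_zero, smul_zero])
  · exact (hback0 P.k).trans (P.smul_flux_total hf hm)
  · exact (smul_inv_smul _ _).symm
  · exact (smul_inv_smul _ _).symm
  · change back (2 * i) + back (2 * i + 1) = (1 - (x : A)) • ((P.twist x (P.cut i))⁻¹ • m (P.cut i))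
    rw [hback0, hback1, twist_cut]
    abel
  · change back (2 * i + 1) + back (2 * (i + 1)) = (1 - (x : A)) •
      ((P.twist x (P.rot (P.rot.symm (P.cut i))))⁻¹ • m (P.rot.symm (P.cut i)))
    have h1 := hfm (P.cut i)
    rw [Equiv.apply_symm_apply, hback0, hback1, flux_succ, ← h1, twist_cut]
    simp only [sub_smul, smul_sub, smul_add, one_smul]
    abel
  · change (P.twist x (Dart.rev d))⁻¹ • m (Dart.rev d) = (P.twist x d)⁻¹ • m d
    have h1 : f d = -((P.twist x d)⁻¹ • P.twistedDiff x w d) := by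
      simp only [f, hd, Units.val_one, one_smul]
    rw [← hfm, ← hgm] at h1
    have h2 := hsum d
    revert h1 h2
    generalize (P.twist x d)⁻¹ • m d = p
    generalize (P.twist x (Dart.rev d))⁻¹ • m (Dart.rev d) = q
    generalize (P.twist x d)⁻¹ • m (P.rot.symm d) = p'
    generalize (P.twist x (Dart.rev d))⁻¹ • m (P.rot.symm (Dart.rev d)) = q'
    intro h1 h2
    rw [← sub_eq_zero] at h1 h2 ⊢
    have h3 : q - p = p + q - (p' + q') - (p - p' - -(p - q')) := by abel
    rw [h3, h1, h2, sub_zero]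
  · change (P.twist x (P.rot (P.rot.symm (Dart.rev d))))⁻¹ • m (P.rot.symm (Dart.rev d)) =
      (P.twist x (P.rot (P.rot.symm d)))⁻¹ • m (P.rot.symm d)
    have h1 : f d = (P.twist x d)⁻¹ • P.twistedDiff x w d := by
      have hs := (Int.units_eq_one_or (G.sign d.1)).resolve_left hd
      simp only [f, hs, Units.val_neg, Units.val_one, neg_smul, one_smul, neg_neg]
    rw [← hfm, ← hgm, sub_right_inj] at h1
    rw [Equiv.apply_symm_apply, Equiv.apply_symm_apply, h1]
  · change (P.twist x d)⁻¹ • m d + (P.twist x (Dart.rev d))⁻¹ • m (Dart.rev d) =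
      (P.twist x (P.rot (P.rot.symm d)))⁻¹ • m (P.rot.symm d) +
      (P.twist x (P.rot (P.rot.symm (Dart.rev d))))⁻¹ • m (P.rot.symm (Dart.rev d))
    rw [Equiv.apply_symm_apply, Equiv.apply_symm_apply]
    exact hsum d
  · have hmS : ∀ d, m d ∈ S := fun d => hαS (.strand d 2)
    have hfS : ∀ d, f d ∈ S := fun d => by
      rw [← hfm, ← smul_sub]
      exact S.smul_mem (((P.twist x d)⁻¹ : Aˣ) : A) (S.sub_mem (hmS _) (hmS _))
    have hρu := hS S hfS
    -- Modulo S, w at a vertex is minus u at each adjacent region, and u vanishes at `path 0`.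
    have := P.induction_of_connected (x₀ := Sum.inr (P.path 0))
      (p := Sum.elim (fun v => w v ∈ S) fun r => u r ∈ S) (by simp [hu]) fun d => by
        have h1 := S.sub_mem (hmS d) (hρu d)
        have h2 : m d - (ρ d - u (P.left d)) = w (G.start d) + u (P.left d) := by
          simp only [m]
          abel
        rw [h2] at h1
        exact ⟨fun hd => (S.add_mem_iff_right hd).1 h1, fun hd => (S.add_mem_iff_left hd).1 h1⟩
    exact fun v => this (Sum.inl v)

end AnnularEmbedding

open Classical in
theorem PeriodicGraph.sum_laplacianMatrix_smul {V E : Type*} [Fintype V] [Fintype E]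
    (G : PeriodicGraph V E) {W : Type*} [AddCommGroup W] [Module ℤ[T;T⁻¹] W]
    (y : V → W) (i : V) :
    ∑ j, G.laplacianMatrix i j • y j = ∑ d, (if G.start d = i then
      (G.sign d.1 : ℤ) • (y i -
        (LaurentPolynomial.T (G.dartShift d) : ℤ[T;T⁻¹]) • y (G.start (Dart.rev d))) else 0) := by
  have hC : ∀ (s : ℤ) (w : W), (LaurentPolynomial.C s : ℤ[T;T⁻¹]) • w = s • w := fun s w => by
    rw [← Int.cast_smul_eq_zsmul ℤ[T;T⁻¹] s w]
    exact congrArg (· • w) (map_intCast (LaurentPolynomial.C : ℤ →+* ℤ[T;T⁻¹]) s)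
  have hD : ∑ j, G.degreeMatrix i j • y j =
      ∑ d, if G.start d = i then (G.sign d.1 : ℤ) • y i else 0 := by
    rw [Finset.sum_eq_single i (fun j _ hj => by
      
      have : G.degreeMatrix i j = 0 := Matrix.diagonal_apply_ne _ (Ne.symm hj)
      rw [this, zero_smul]) (by simp)]
    have : G.degreeMatrix i i =
        ∑ d, if G.start d = i then LaurentPolynomial.C (G.sign d.1 : ℤ) else 0 := Matrix.diagonal_apply_eq _ i
    simp only [this, Finset.sum_smul, ite_smul, hC, zero_smul]
  have hA : ∑ j, G.adjacencyMatrix i j • y j = ∑ d, if G.start d = i then (G.sign d.1 : ℤ) •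
      (LaurentPolynomial.T (G.dartShift d) : ℤ[T;T⁻¹]) • y (G.start (Dart.rev d)) else 0 := by
    simp only [adjacencyMatrix, Matrix.of_apply, Finset.sum_smul]
    rw [Finset.sum_comm]
    refine Finset.sum_congr rfl fun d _ => ?_
    rw [Finset.sum_eq_single (G.start (Dart.rev d)) (fun j _ hj => by
      simp [Ne.symm hj]) (by simp)]
    simp only [and_true, ite_smul, mul_smul, hC, zero_smul]
  simp only [laplacianMatrix, Matrix.sub_apply, sub_smul, Finset.sum_sub_distrib, hD, hA]
  rw [← Finset.sum_sub_distrib]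
  refine Finset.sum_congr rfl fun d _ => ?_
  split_ifs
  · rw [smul_sub]
  · rw [sub_zero]

/-! ### Comparison of the Laplacian with the Alexander minor. -/

namespace AnnularEmbedding

variable {V E R : Type*} [Fintype V] [Fintype E] [Fintype R] {G : PeriodicGraph V E}

theorem val_unitX_zpow (n : ℤ) :
    ((unitX ^ n : ℤ[T;T⁻¹]ˣ) : ℤ[T;T⁻¹]) = LaurentPolynomial.T n := by
  have h1 : (unitX : ℤ[T;T⁻¹]) = LaurentPolynomial.T 1 := rfl
  have h2 : ((unitX⁻¹ : ℤ[T;T⁻¹]ˣ) : ℤ[T;T⁻¹]) = LaurentPolynomial.T (-1) :=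
    Units.inv_eq_of_mul_eq_one_right (by rw [h1, ← LaurentPolynomial.T_add, add_neg_cancel,
      LaurentPolynomial.T_zero])
  induction n with
  | zero => simp
  | succ n ih => rw [zpow_add_one, Units.val_mul, ih, h1, LaurentPolynomial.T_add]
  | pred n ih => rw [zpow_sub_one, Units.val_mul, ih, h2, ← LaurentPolynomial.T_add, sub_eq_add_neg]

variable {P : AnnularEmbedding G R}

theorem twist_eq_zpow {A : Type*} [CommRing A] (x : Aˣ) (d : E × Bool) :
    P.twist x d = x ^ (Nat.card {i // P.cut i = d} : ℤ) := by
  by_cases hd : d ∈ Set.range P.cut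
  · obtain ⟨i, rfl⟩ := hd
    have : Nat.card {j // P.cut j = P.cut i} = 1 :=
      Nat.card_eq_one_iff_exists.2 ⟨⟨i, rfl⟩, fun j => Subtype.ext (P.cut_injective j.2)⟩
    rw [twist_cut, this, Nat.cast_one, zpow_one]
  · have : IsEmpty {j // P.cut j = d} := ⟨fun j => hd ⟨j.1, j.2⟩⟩
    rw [twist, if_neg hd, Nat.card_of_isEmpty, Nat.cast_zero, zpow_zero]

theorem twist_mul_inv_twist_rev {A : Type*} [CommRing A] (x : Aˣ) (d : E × Bool) :
    P.twist x d * (P.twist x (Dart.rev d))⁻¹ =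
      x ^ (G.dartShift d + P.level (G.start (Dart.rev d)) - P.level (G.start d)) := by
  rw [twist_eq_zpow, twist_eq_zpow, ← zpow_neg, ← zpow_add]
  congr 1
  obtain ⟨e, _ | _⟩ := d
  · have := P.shift_eq e
    simp only [Dart.rev, PeriodicGraph.dartShift, PeriodicGraph.start, Bool.not_false, if_true,
      Bool.false_eq_true, if_false]
    linarith
  · have := P.shift_eq e
    simp only [Dart.rev, PeriodicGraph.dartShift, PeriodicGraph.start, Bool.not_true, if_true,
      Bool.false_eq_true, if_false]
    linarith

/-- The kernel of the Laplacian consists of the harmonic functions, up to powers of `x`. -/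
theorem sum_laplacianMatrix_smul_eq_zero_iff {W : Type*} [AddCommGroup W] [Module ℤ[T;T⁻¹] W]
    (w : V → W) :
    (∀ i, ∑ j, G.laplacianMatrix i j • unitX ^ P.level j • w j = 0) ↔
      P.IsHarmonic unitX w := by
  classical
  refine forall_congr' fun i => ?_
  -- Rescaling by the powers x^level turns the shift of an edge into its signed number of crossings
  -- with γ, by `shift_eq`.
  have key : ∑ j, G.laplacianMatrix i j • unitX ^ P.level j • w j = unitX ^ P.level i •
      ∑ d, (if G.start d = i then (G.sign d.1 : ℤ) • P.twistedDiff unitX w d else 0) := by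
    rw [G.sum_laplacianMatrix_smul (fun j => unitX ^ P.level j • w j), Finset.smul_sum]
    refine Finset.sum_congr rfl fun d _ => ?_
    split_ifs with hd
    · subst hd
      rw [smul_comm (unitX ^ P.level (G.start d))]
      refine congrArg ((G.sign d.1 : ℤ) • ·) ?_
      rw [twistedDiff, smul_sub, smul_smul, twist_mul_inv_twist_rev, ← zpow_add,
        ← val_unitX_zpow, ← Units.smul_def, smul_smul, ← zpow_add]
      congr 3
      ring
    · rw [smul_zero]
  rw [key, smul_eq_zero_iff_eq]

variable (o : P.Orientation)

theorem finite_crossing (o : P.Orientation) : Finite P.Crossing :=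
  Finite.of_injective (underSegment o) fun c c' h => by
    simpa using pass_injective o (a₁ := Sum.inr c) (a₂ := Sum.inr c') h

theorem arc_front (j : Fin (2 * P.k + 1)) :
    (encircledLink o).arc (.front j) = (encircledLink o).arc (.front 0) := by
  obtain ⟨j, hj⟩ := j
  induction j with
  | zero => rfl
  | succ j ih =>
    rw [← ih (by omega), ← (encircledLink o).arc_next (s := .front ⟨j, by omega⟩)
      (front_notMem_range_underSegment o _)]
    simp [encircledLink_next, nextSegment, show j < 2 * P.k by omega]

/-- The minor of the Alexander matrix that omits the overpassing arc of the meridian and one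
crossing specializes to the Laplacian polynomial. -/
theorem associated_specialize_alexanderMinor
    (f : {a // a ≠ (encircledLink o).arc (.front 0)} → P.Crossing)
    (hf : ∀ c, (encircledLink o).alexanderRow c ∈
      Submodule.span (MvLaurent (encircledLink o).Component)
        (Set.range ((encircledLink o).alexanderRow ∘ f))) :
    Associated G.laplacianPolynomial
      (specialize o ((encircledLink o).alexanderMinor ((encircledLink o).arc (.front 0)) f)) := by
  classical
  let : Finite (encircledLink o).Arc := inferInstanceAs (Finite (Quot _))
  let : Fintype (encircledLink o).Arc := Fintype.ofFinite _
  generalize hj₀ : (encircledLink o).arc (.front 0) = j₀ at f hf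
  set M : Matrix {a // a ≠ j₀} {a // a ≠ j₀} ℤ[T;T⁻¹] := Matrix.of fun a b =>
    specialize o ((encircledLink o).alexanderMatrix (f a) b.1) with hM
  have hdet : specialize o ((encircledLink o).alexanderMinor j₀ f) = M.det := by
    rw [LinkDiagram.alexanderMinor_eq, RingHom.map_det]
    rfl
  have hL : G.laplacianPolynomial = G.laplacianMatrix.det := by
    rw [PeriodicGraph.laplacianPolynomial]
  rw [hdet, hL]
  apply associated_of_dvd_dvd
  · apply Matrix.det_dvd_det_of_solutions
    intro W _ _ e he
    have hw : P.IsHarmonic unitX fun v => unitX ^ (-P.level v) • e v := by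
      rw [← sum_laplacianMatrix_smul_eq_zero_iff]
      simpa only [zpow_neg, smul_inv_smul] using he
    obtain ⟨α, hα, hS⟩ := hw.exists_isColoring
    let a : (encircledLink o).Arc → W := Quot.lift α fun s s' h => by
      rw [← h.1]
      exact (hα.apply_next o s h.2).symm
    have ha : a j₀ = 0 := by
      rw [← hj₀]
      exact hα.front 0
    refine ⟨fun b => a b.1, fun i => ?_, fun v => ?_⟩
    · have h := (sum_alexanderMatrix_eq_zero_iff o a α (fun _ => rfl) hα.front (f i)).2
        (hα.crossingRelation o (f i))
      rwa [Fintype.sum_eq_add_sum_subtype_ne _ j₀, ha, smul_zero, zero_add] at h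
    · rw [← smul_inv_smul (unitX ^ P.level v) (e v), ← zpow_neg]
      refine Submodule.smul_mem _ ((unitX ^ P.level v : ℤ[T;T⁻¹]ˣ) : ℤ[T;T⁻¹])
        (hS _ (fun s => ?_) v)
      change a ((encircledLink o).arc s) ∈ _
      by_cases hs : (encircledLink o).arc s = j₀
      · rw [hs, ha]
        exact Submodule.zero_mem _
      · exact Submodule.subset_span ⟨⟨_, hs⟩, rfl⟩
  · apply Matrix.det_dvd_det_of_solutions
    intro W _ _ e he
    let a : (encircledLink o).Arc → W := fun b => if h : b ≠ j₀ then e ⟨b, h⟩ else 0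
    have ha : a j₀ = 0 := dif_neg (by simp)
    have ha' : ∀ b : {a // a ≠ j₀}, a b.1 = e b := fun b => dif_pos b.2
    -- The selected rows span all rows, so the omitted crossing imposes its relation as well.
    have hrow : ∀ c, ∑ b, specialize o ((encircledLink o).alexanderRow c b) • a b = 0 := by
      intro c
      have hr := hf c
      generalize (encircledLink o).alexanderRow c = r at hr
      induction hr using Submodule.span_induction with
      | mem r hr =>
        obtain ⟨i, rfl⟩ := hr
        rw [Fintype.sum_eq_add_sum_subtype_ne _ j₀, ha, smul_zero, zero_add]
        simp only [ha']
        exact he i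
      | zero => simp
      | add r r' _ _ h h' => simp [add_smul, Finset.sum_add_distrib, h, h']
      | smul t r _ h => simp [mul_smul, ← Finset.smul_sum, h]
    have hfront : ∀ j, a ((encircledLink o).arc (.front j)) = 0 := fun j => by
      rw [arc_front, hj₀, ha]
    have hα : IsColoring unitX P fun s => a ((encircledLink o).arc s) := by
      refine isColoring_of_crossingRelation o unitX (fun s hs => ?_) (hfront 0) fun c =>
        (sum_alexanderMatrix_eq_zero_iff o a _ (fun _ => rfl) hfront c).1 (hrow c)
      exact congrArg a ((encircledLink o).arc_next hs)
    obtain ⟨w, hw, hS⟩ := hα.exists_isHarmonic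
    refine ⟨fun v => unitX ^ P.level v • w v, sum_laplacianMatrix_smul_eq_zero_iff w |>.2 hw,
      fun b => ?_⟩
    obtain ⟨s, hs⟩ := Quot.exists_rep b.1
    rw [← ha', ← hs]
    refine hS _ (fun v => ?_) s
    rw [← inv_smul_smul (unitX ^ P.level v) (w v)]
    exact Submodule.smul_mem _ (((unitX ^ P.level v)⁻¹ : ℤ[T;T⁻¹]ˣ) : ℤ[T;T⁻¹])
      (Submodule.subset_span ⟨v, rfl⟩)

end AnnularEmbedding

theorem mainTheorem3 {V E R : Type*} [Fintype V] [Fintype E] [Fintype R]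
    (G : PeriodicGraph V E) (P : AnnularEmbedding G R) (o : P.Orientation) :
    (∃ Δ, (AnnularEmbedding.encircledLink o).IsAlexanderPolynomial Δ) ∧
      ∀ Δ, (AnnularEmbedding.encircledLink o).IsAlexanderPolynomial Δ →
        Associated G.laplacianPolynomial
          ((LaurentPolynomial.T 1 - 1) * AnnularEmbedding.specialize o Δ) := by
  -- Every region has an edge on its boundary. The crossing of this edge serves as the row to omit,
  -- and its strand as a component other than C.
  obtain ⟨d, -⟩ := P.left_surjective (P.path 0)
  have : Finite P.Crossing := AnnularEmbedding.finite_crossing o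
  let : Fintype P.Crossing := Fintype.ofFinite _
  obtain ⟨f, hf⟩ := (AnnularEmbedding.encircledLink o).exists_rows
    ((AnnularEmbedding.encircledLink o).arc (.front 0)) (.edge d.1)
  obtain ⟨lab, hlab⟩ := AnnularEmbedding.exists_numbering o
  have hrows := hlab.row_mem_span _ hf
  obtain ⟨q, hq, hmin⟩ := (AnnularEmbedding.encircledLink o).exists_isAlexanderPolynomial
    ((AnnularEmbedding.encircledLink o).arc (.front 0))
    ((AnnularEmbedding.encircledLink o).arc (.strand d 0))
    (AnnularEmbedding.strandComponent_ne_circle o d).symm f hrows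
  refine ⟨⟨q, hq⟩, fun Δ hΔ => ?_⟩
  have h := AnnularEmbedding.associated_specialize_alexanderMinor o f hrows
  have hx : AnnularEmbedding.specialize o
      ((MvLaurent.var ((AnnularEmbedding.encircledLink o).arcComponent
        ((AnnularEmbedding.encircledLink o).arc (.front 0))) : MvLaurent _) - 1) =
      LaurentPolynomial.T 1 - 1 := by
    rw [map_sub, map_one, AnnularEmbedding.specialize_var]
    exact congrArg (fun u : ℤ[T;T⁻¹]ˣ => (u : ℤ[T;T⁻¹]) - 1) (if_pos rfl)
  rw [hmin, map_mul, hx] at h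
  exact h.trans (((hq.associated _ hΔ).map (AnnularEmbedding.specialize o)).mul_left _)

end
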